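/- Languages and oracles are subsets of $\{0,1\}^*$, identified with their characteristic functions. A polynomial-time oracle machine is a deterministic oracle Turing machine whose running time, for every oracle and every input, is at most a fixed polynomial in the total length of the input. For oracles $A_0,A_1$ let $M^{A_0,A_1}$ denote $M^A$, where $A(i\cdot q)=A_i(q)$ for $i\in\{0,1\}$ and $q\in\{0,1\}^*$. A probabilistic polynomial-time oracle machine is a polynomial-time oracle machine $M$ that receives, besides its input $x$, a uniformly random string of $\rho(|x|)$ coin flips, for some polynomial $\rho$. For a language $L$ and an oracle $R$: * A *selector* for $L$ is a probabilistic polynomial-time oracle machine $S$ such that $\Pr[S^{A_0,A_1}(x)=L(x)]\ge \frac23$ for all $x\in\{0,1\}^*$ and all oracles $A_0,A_1\subseteq\{0,1\}^*$ with $L\in\{A_0,A_1\}$, where the probability is over the coin flips of $S$. * $L$ is *paddable* if some polynomial-time machine (without oracle), on input $(x,1^m)$ with $|x|\le m$, outputs a string $y$ of length $m$ such that $y\in L$ if and only if $x\in L$. * $L\in\mathrm{BPP}^R$ if there is a probabilistic polynomial-time oracle machine $M$ with $\Pr[M^R(x)=L(x)]\ge\frac23$ for all $x\in\{0,1\}^*$.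 * $L\in\mathrm{BPP}^R/\!/\log$ if there are a polynomial-time oracle machine $M$, a polynomial $\rho$ and advice strings $\alpha_n(r)\in\{0,1\}^*$ for $n\in\mathbb N$ and $r\in\{0,1\}^{\rho(n)}$, with $|\alpha_n(r)|=O(\log n)$ uniformly in $r$, such that for every $n\in\mathbb N$ $$\Pr_{r\in\{0,1\}^{\rho(n)}}\bigl[\forall x\in\{0,1\}^n:\ M^R(x,r,\alpha_n(r))=L(x)\bigr]\ge\tfrac56 .$$ * $L\in\mathrm{P}^R/1$ if there are a polynomial-time oracle machine $M$ and bits $\alpha_n\in\{0,1\}$ ($n\in\mathbb N$) with $M^R(x,\alpha_{|x|})=L(x)$ for all $x\in\{0,1\}^*$. **Theorem.** 1. For every paddable language $L$: if $L$ has a selector, then for every oracle $R\subseteq\{0,1\}^*$, $L\in\mathrm{BPP}^R/\!/\log$ implies $L\in\mathrm{BPP}^R$. 2. For every language $L$: if for every oracle $R\subseteq\{0,1\}^*$, $L\in\mathrm{P}^R/1$ implies $L\in\mathrm{BPP}^R$, then $L$ has a selector. -/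

import Mathlib

namespace Selectors

/-- A language over the alphabet `{0, 1}`, identified with its characteristic function;
oracles are languages too. -/
abbrev Lang : Type := List Bool → Bool

/-! ### Oracle machines

The machine model is the multi-stack form of the multi-tape oracle Turing machine (as in
`Turing.TM2`): a finite control together with stacks of bits, the head of a list being the top.
A tape is a pair of stacks (the cells to the left of the head and the cells from the head on), and a
larger tape alphabet is encoded by blocks of bits, so that this model and multi-tape Turing machines
simulate each other with constant overhead per step. -/

/-- The instruction attached to a control state; `Q` is the set of control states. -/
inductive Instr (Q : Type) : Type where
  /-- push the bit `b` on stack `i`, go to `q` -/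
  | push (i : ℕ) (b : Bool) (q : Q) : Instr Q
  /-- remove the top of stack `i` and go to `qf` or `qt` according to the bit removed;
  go to `qe` if the stack is empty -/
  | pop (i : ℕ) (qe qf qt : Q) : Instr Q
  /-- ask the oracle about the string that stack `i` holds (read from the top, and left in place);
  go to `qf` or `qt` according to the answer -/
  | query (i : ℕ) (qf qt : Q) : Instr Q
  /-- stop -/
  | halt : Instr Q

/-- A deterministic oracle machine. Only finitely many stacks occur in its finitely many
instructions; all others are inert. -/
structure OracleMachine : Type 1 where
  /-- control states -/
  Q : Type
  /-- there are finitely many of them -/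
  finite_states : Finite Q
  /-- initial state -/
  start : Q
  /-- the instruction executed in each state -/
  code : Q → Instr Q

/-- A configuration: the control state and the contents of the stacks. -/
structure Cfg (Q : Type) : Type where
  /-- current control state -/
  state : Q
  /-- contents of the stacks -/
  stack : ℕ → List Bool

namespace OracleMachine

/-- One step of computation with oracle `A`. A halted configuration does not change any more. -/
def step (M : OracleMachine) (A : Lang) (c : Cfg M.Q) : Cfg M.Q :=
  match M.code c.state with
  | Instr.push i b q => ⟨q, Function.update c.stack i (b :: c.stack i)⟩
  | Instr.pop i qe qf qt =>
    match c.stack i with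
    | [] => ⟨qe, c.stack⟩
    | false :: w => ⟨qf, Function.update c.stack i w⟩
    | true :: w => ⟨qt, Function.update c.stack i w⟩
  | Instr.query i qf qt => ⟨if A (c.stack i) = true then qt else qf, c.stack⟩
  | Instr.halt => c

/-- The initial configuration: the input is a tuple of strings, the `i`-th of which is on stack `i`
(counting from `0`); all other stacks are empty. -/
def init (M : OracleMachine) (w : List (List Bool)) : Cfg M.Q :=
  ⟨M.start, fun i => w.getD i []⟩

/-- The configuration after `t` steps on input `w` with oracle `A`. -/
def run (M : OracleMachine) (A : Lang) (w : List (List Bool)) (t : ℕ) : Cfg M.Q :=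
  (M.step A)^[t] (M.init w)

/-- `M`, on input `w` with oracle `A`, has halted after at most `t` steps. -/
def HaltsWithin (M : OracleMachine) (A : Lang) (w : List (List Bool)) (t : ℕ) : Prop :=
  M.code (M.run A w t).state = Instr.halt

/-- `M^A(w) = y`: the machine halts, and then stack `0` holds the string `y`. -/
def Outputs (M : OracleMachine) (A : Lang) (w : List (List Bool)) (y : List Bool) : Prop :=
  ∃ t : ℕ, M.HaltsWithin A w t ∧ (M.run A w t).stack 0 = y

/-- `M` is a polynomial-time oracle machine with `k` input strings: for all oracles and all inputs
the number of steps is bounded by a polynomial in the total length of the input. -/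
def PolyTime (M : OracleMachine) (k : ℕ) : Prop :=
  ∃ p : Polynomial ℕ, ∀ (A : Lang) (w : List (List Bool)), w.length = k →
    M.HaltsWithin A w (p.eval (w.map List.length).sum)

/-- `M` has no query instruction, so that it is an ordinary machine without oracle. -/
def QueryFree (M : OracleMachine) : Prop :=
  ∀ (s : M.Q) (i : ℕ) (qf qt : M.Q), M.code s ≠ Instr.query i qf qt

end OracleMachine

/-- The oracle `A` with `A (i · q) = A_i q` for `i ∈ {0, 1}`, through which a machine accesses
two oracles `A₀` and `A₁`. (The empty string, which is not of this form, is not in `A`.) -/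
def join (A₀ A₁ : Lang) : Lang
  | [] => false
  | false :: q => A₀ q
  | true :: q => A₁ q

/-- The probability of the event `E` for a uniformly random string `r ∈ {0, 1}^m`. -/
noncomputable def coinProb (m : ℕ) (E : List Bool → Prop) : ℝ :=
  (Nat.card {r : Fin m → Bool // E (List.ofFn r)} : ℝ) / 2 ^ m

/-- The probability that `M^A(x) = b`, where `M` is a probabilistic machine that uses `ρ(|x|)` coin
flips on input `x`; the coin flips are the second input string. -/
noncomputable def answerProb (M : OracleMachine) (ρ : Polynomial ℕ) (A : Lang) (x : List Bool)
    (b : Bool) : ℝ :=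
  coinProb (ρ.eval x.length) fun r => M.Outputs A [x, r] [b]

/-- `L ∈ BPP^R`. -/
def InBPP (R L : Lang) : Prop :=
  ∃ (M : OracleMachine) (ρ : Polynomial ℕ), M.PolyTime 2 ∧
    ∀ x : List Bool, 2 / 3 ≤ answerProb M ρ R x (L x)

/-- `L ∈ BPP^R//log`: the advice is a string of length `O(log n)` that may depend on the
coin flips `r` in addition to the input length `n`. -/
def InBPPLogAdvice (R L : Lang) : Prop :=
  ∃ (M : OracleMachine) (ρ : Polynomial ℕ) (α : ℕ → List Bool → List Bool) (c : ℕ),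
    M.PolyTime 3 ∧
    (∀ (n : ℕ) (r : List Bool), r.length = ρ.eval n →
      (α n r).length ≤ c * Nat.log 2 n + c) ∧
    ∀ n : ℕ, 5 / 6 ≤ coinProb (ρ.eval n) fun r =>
      ∀ x : List Bool, x.length = n → M.Outputs R [x, r, α n r] [L x]

/-- `L ∈ P^R/1`: one bit of advice for each input length. -/
def InPOneAdvice (R L : Lang) : Prop :=
  ∃ (M : OracleMachine) (α : ℕ → Bool), M.PolyTime 2 ∧
    ∀ x : List Bool, M.Outputs R [x, [α x.length]] [L x]

/-- `L` has a (probabilistic) selector. -/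
def HasSelector (L : Lang) : Prop :=
  ∃ (S : OracleMachine) (ρ : Polynomial ℕ), S.PolyTime 2 ∧
    ∀ (x : List Bool) (A₀ A₁ : Lang), (A₀ = L ∨ A₁ = L) →
      2 / 3 ≤ answerProb S ρ (join A₀ A₁) x (L x)

/-- `L` is paddable: a polynomial-time machine, given `x` and `1^m` with `|x| ≤ m`, outputs a string
`y` of length `m` such that `y ∈ L` if and only if `x ∈ L`. -/
def Paddable (L : Lang) : Prop :=
  ∃ M : OracleMachine, M.QueryFree ∧ M.PolyTime 2 ∧
    ∀ (x : List Bool) (m : ℕ), x.length ≤ m →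
      ∃ y : List Bool, M.Outputs (fun _ => false) [x, List.replicate m true] y ∧
        y.length = m ∧ L y = L x

end Selectors

/-!
The first part is an argument about choosing among candidates. Fix coin flips `r` that are good for
the length `m`, where `m` bounds the length of all queries that the selector makes on the input `x`.
For each advice string `w`, the advice machine together with the padding machine turns a query `q`
with `|q| ≤ m` into a string of length exactly `m` and so yields an oracle `A_w`
(`adviceOracle`); for the right advice it agrees with `L` on all short strings
(`adviceOracle_eq`). Only polynomially many `w` have logarithmic length
(`exists_lt_nthString_eq`), and it is not necessary to find the right one. For each pair `w`, `w'`,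
take the majority vote of many runs of the selector on `A_w`, `A_w'`, and accept if some `w` gets the
answer "yes" against all `w'`. If the right advice string wins all its duels with the correct answer,
whether it is the first or the second contestant, then this rule gives the correct answer as well
(`tournament_eq`). By Chebyshev's inequality (`coinProb_majority_le`) and the union bound this
happens with probability at least `4 / 5`, and `5 / 6 * (4 / 5) = 2 / 3`.

The second part is an argument by Baire category. Consider the compact space of all oracles that,
for each length `n`, agree with `L` on the strings of length `n` behind the prefix `0` or behind the
prefix `1` (`HalvesContain`). One bit of advice tells which prefix is the right one, so that by
assumption `L` is in `BPP` relative to each of these oracles. There are only countably many machines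
(`exists_code`), and the set of oracles relative to which a given machine decides `L` is closed, since
the success probability on each input is locally constant (`isLocallyConstant_answerProb`). So a
single machine works for a whole neighbourhood, that is, for all oracles of the space that agree with
a fixed one on short strings. With its oracle patched on these finitely many strings, this machine is
a selector (`hasSelector_of_forall_oracle`).

Both parts need actual machines. These are obtained from the class `FP` of functions of an oracle and
several strings that some machine computes in polynomial time, uniformly in the oracle. The class is
shown to be closed under composition (`FP.comp`), recursion on notation with polynomially bounded
values (`FP.fold`), and running a given machine with its queries answered by a predicate of the
class (`FP.output`); after that, all algorithms are written as functions. The machine constructions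
rest on a single combinator, the flow chart `OracleMachine.graph`.
-/

namespace Selectors

/-! ### Executions from arbitrary stores -/

/-- The contents of all stacks. -/
abbrev Store : Type := ℕ → List Bool

namespace Instr

variable {Q Q' : Type}

/-- Rename the target states of an instruction. -/
def map (f : Q → Q') : Instr Q → Instr Q'
  | push i b q => push i b (f q)
  | pop i qe qf qt => pop i (f qe) (f qf) (f qt)
  | query i qf qt => query i (f qf) (f qt)
  | halt => halt

/-- Rename the stacks of an instruction. -/
def reindex (φ : ℕ → ℕ) : Instr Q → Instr Q
  | push i b q => push (φ i) b q
  | pop i qe qf qt => pop (φ i) qe qf qt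
  | query i qf qt => query (φ i) qf qt
  | halt => halt

/-- The effect of an instruction executed in state `q`; this is `OracleMachine.step` detached from
the machine. -/
def act (A : Lang) (q : Q) (σ : Store) : Instr Q → Cfg Q
  | push i b q => ⟨q, Function.update σ i (b :: σ i)⟩
  | pop i qe qf qt =>
    match σ i with
    | [] => ⟨qe, σ⟩
    | false :: w => ⟨qf, Function.update σ i w⟩
    | true :: w => ⟨qt, Function.update σ i w⟩
  | query i qf qt => ⟨if A (σ i) = true then qt else qf, σ⟩
  | halt => ⟨q, σ⟩

/-- An instruction that only changes the state. -/
def goto (q : Q) : Instr Q := query 0 q q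

theorem act_goto (A : Lang) (q q' : Q) (σ : Store) : act A q σ (goto q') = ⟨q', σ⟩ := by
  simp [goto, act]

theorem act_map (f : Q → Q') (A : Lang) (q : Q) (σ : Store) (I : Instr Q) :
    act A (f q) σ (I.map f) = ⟨f (act A q σ I).state, (act A q σ I).stack⟩ := by
  cases I with
  | push i b q => rfl
  | pop i qe qf qt => rcases h : σ i with _ | ⟨_ | _, w⟩ <;> simp [map, act, h]
  | query i qf qt => by_cases h : A (σ i) = true <;> simp [map, act, h]
  | halt => rfl

theorem map_eq_halt {f : Q → Q'} {I : Instr Q} : I.map f = halt ↔ I = halt := by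
  cases I <;> simp [map]

/-- No stack grows by more than one bit. -/
theorem length_act_le (A : Lang) (q : Q) (σ : Store) (I : Instr Q) (j : ℕ) :
    ((act A q σ I).stack j).length ≤ (σ j).length + 1 := by
  cases I with
  | push i b q => by_cases h : j = i <;> simp [act, Function.update, h]
  | pop i qe qf qt =>
    rcases h : σ i with _ | ⟨_ | _, w⟩ <;> by_cases h' : j = i <;>
      simp [act, h, Function.update, h'] <;> omega
  | query i qf qt => simp [act]
  | halt => simp [act]

end Instr

namespace OracleMachine

theorem step_eq (M : OracleMachine) (A : Lang) (c : Cfg M.Q) :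
    M.step A c = Instr.act A c.state c.stack (M.code c.state) := by
  unfold step Instr.act
  cases M.code c.state <;> rfl

theorem step_of_halt {M : OracleMachine} {A : Lang} {c : Cfg M.Q}
    (h : M.code c.state = Instr.halt) : M.step A c = c := by
  rw [step_eq, h]; rfl

theorem iterate_step_of_halt {M : OracleMachine} {A : Lang} {c : Cfg M.Q}
    (h : M.code c.state = Instr.halt) (t : ℕ) : (M.step A)^[t] c = c :=
  Function.iterate_fixed (step_of_halt h) t

/-- Started with store `σ`, the machine `M` halts within `t` steps with store `τ`. -/
def Exec (M : OracleMachine) (A : Lang) (σ : Store) (t : ℕ) (τ : Store) : Prop :=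
  ∃ q, M.code q = Instr.halt ∧ (M.step A)^[t] ⟨M.start, σ⟩ = ⟨q, τ⟩

theorem Exec.mono {M : OracleMachine} {A : Lang} {σ τ : Store} {t t' : ℕ}
    (h : M.Exec A σ t τ) (htt : t ≤ t') : M.Exec A σ t' τ := by
  obtain ⟨q, hq, h⟩ := h
  obtain ⟨d, rfl⟩ := Nat.exists_eq_add_of_le' htt
  refine ⟨q, hq, ?_⟩
  rw [Function.iterate_add_apply, h, iterate_step_of_halt hq]

theorem length_iterate_le (M : OracleMachine) (A : Lang) (c : Cfg M.Q) (t j : ℕ) :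
    (((M.step A)^[t] c).stack j).length ≤ (c.stack j).length + t := by
  induction t with
  | zero => simp
  | succ t ih =>
    rw [Function.iterate_succ_apply', step_eq]
    have := Instr.length_act_le A ((M.step A)^[t] c).state ((M.step A)^[t] c).stack
      (M.code ((M.step A)^[t] c).state) j
    omega

theorem Exec.length_le {M : OracleMachine} {A : Lang} {σ τ : Store} {t : ℕ}
    (h : M.Exec A σ t τ) (j : ℕ) : (τ j).length ≤ (σ j).length + t := by
  obtain ⟨q, -, h⟩ := h
  simpa [h] using M.length_iterate_le A ⟨M.start, σ⟩ t j

theorem Exec.haltsWithin {M : OracleMachine} {A : Lang} {w : List (List Bool)} {t : ℕ} {τ : Store}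
    (h : M.Exec A (fun i => w.getD i []) t τ) : M.HaltsWithin A w t := by
  obtain ⟨q, hq, h⟩ := h
  unfold HaltsWithin run init
  rw [h]
  exact hq

theorem Exec.outputs {M : OracleMachine} {A : Lang} {w : List (List Bool)} {t : ℕ} {τ : Store}
    (h : M.Exec A (fun i => w.getD i []) t τ) : M.Outputs A w (τ 0) := by
  refine ⟨t, h.haltsWithin, ?_⟩
  obtain ⟨q, hq, h⟩ := h
  unfold run init
  rw [h]

theorem HaltsWithin.run_eq {M : OracleMachine} {A : Lang} {w : List (List Bool)} {t t' : ℕ}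
    (h : M.HaltsWithin A w t) (htt : t ≤ t') : M.run A w t' = M.run A w t := by
  obtain ⟨d, rfl⟩ := Nat.exists_eq_add_of_le' htt
  rw [run, Function.iterate_add_apply]
  exact iterate_step_of_halt h d

theorem HaltsWithin.outputs_iff {M : OracleMachine} {A : Lang} {w : List (List Bool)} {t : ℕ}
    (h : M.HaltsWithin A w t) (y : List Bool) :
    M.Outputs A w y ↔ (M.run A w t).stack 0 = y := by
  refine ⟨fun ⟨t', h', hy⟩ => ?_, fun hy => ⟨t, h, hy⟩⟩
  rcases le_total t t' with htt | htt
  · rw [← h.run_eq htt, hy]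
  · rw [h'.run_eq htt, hy]

/-! ### Renaming stacks -/

/-- The machine `M` with its stacks renamed by `φ`. -/
def reloc (M : OracleMachine) (φ : ℕ → ℕ) : OracleMachine where
  Q := M.Q
  finite_states := M.finite_states
  start := M.start
  code q := (M.code q).reindex φ

theorem act_reindex {Q : Type} {φ : ℕ → ℕ} (hφ : Function.Injective φ) (A : Lang) (q : Q)
    (σ : Store) (I : Instr Q) :
    (Instr.act A q σ (I.reindex φ)).state = (Instr.act A q (σ ∘ φ) I).state ∧
    (Instr.act A q σ (I.reindex φ)).stack ∘ φ = (Instr.act A q (σ ∘ φ) I).stack ∧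
    ∀ j, j ∉ Set.range φ → (Instr.act A q σ (I.reindex φ)).stack j = σ j := by
  have hne : ∀ {i j}, j ∉ Set.range φ → j ≠ φ i := fun h h' => h ⟨_, h'.symm⟩
  cases I with
  | push i b q =>
    refine ⟨rfl, ?_, fun j hj => ?_⟩
    · simp [Instr.act, Instr.reindex, Function.update_comp_eq_of_injective _ hφ]
    · simp [Instr.act, Instr.reindex, Function.update_of_ne (hne hj)]
  | pop i qe qf qt =>
    rcases h : σ (φ i) with _ | ⟨_ | _, w⟩
    · exact ⟨by simp [Instr.act, Instr.reindex, h], by simp [Instr.act, Instr.reindex, h],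
        by simp [Instr.act, Instr.reindex, h]⟩
    all_goals
      refine ⟨by simp [Instr.act, Instr.reindex, h], ?_, fun j hj => ?_⟩
      · simp [Instr.act, Instr.reindex, h, Function.update_comp_eq_of_injective _ hφ]
      · simp [Instr.act, Instr.reindex, h, Function.update_of_ne (hne hj)]
  | query i qf qt => exact ⟨rfl, rfl, fun _ _ => rfl⟩
  | halt => exact ⟨rfl, rfl, fun _ _ => rfl⟩

theorem Exec.reloc {M : OracleMachine} {A : Lang} {φ : ℕ → ℕ} (hφ : Function.Injective φ)
    {σ τ σ' : Store} {t : ℕ} (h : M.Exec A (σ ∘ φ) t τ) (h1 : σ' ∘ φ = τ)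
    (h2 : ∀ j, j ∉ Set.range φ → σ' j = σ j) : (M.reloc φ).Exec A σ t σ' := by
  obtain ⟨q, hq, h⟩ := h
  have key : ∀ t, (((M.reloc φ).step A)^[t] ⟨M.start, σ⟩).state =
        ((M.step A)^[t] ⟨M.start, σ ∘ φ⟩).state ∧
      (((M.reloc φ).step A)^[t] ⟨M.start, σ⟩).stack ∘ φ =
        ((M.step A)^[t] ⟨M.start, σ ∘ φ⟩).stack ∧
      ∀ j, j ∉ Set.range φ → (((M.reloc φ).step A)^[t] ⟨M.start, σ⟩).stack j = σ j := by
    intro t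
    induction t with
    | zero => exact ⟨rfl, rfl, fun _ _ => rfl⟩
    | succ t ih =>
      obtain ⟨i1, i2, i3⟩ := ih
      simp only [Function.iterate_succ_apply']
      have := act_reindex hφ A (((M.reloc φ).step A)^[t] ⟨M.start, σ⟩).state
        (((M.reloc φ).step A)^[t] ⟨M.start, σ⟩).stack
        (M.code (((M.reloc φ).step A)^[t] ⟨M.start, σ⟩).state)
      rw [step_eq, step_eq, ← i1, ← i2]
      exact ⟨this.1, this.2.1, fun j hj => (this.2.2 j hj).trans (i3 j hj)⟩
  obtain ⟨k1, k2, k3⟩ := key t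
  rw [h] at k1 k2
  refine ⟨q, by simp [OracleMachine.reloc, hq, Instr.reindex], ?_⟩
  have hs : (((M.reloc φ).step A)^[t] ⟨M.start, σ⟩).stack = σ' := by
    funext j
    by_cases hj : j ∈ Set.range φ
    · obtain ⟨i, rfl⟩ := hj
      exact (congrFun k2 i).trans (congrFun h1 i).symm
    · rw [k3 j hj, h2 j hj]
  change ((M.reloc φ).step A)^[t] ⟨M.start, σ⟩ = ⟨q, σ'⟩
  rw [← hs]
  exact congrArg (fun s => Cfg.mk s _) k1

/-! ### Flow charts -/

/-- A flow chart: in each node `n` of the control machine `C`, first run the machine `body n` until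
it halts, then execute the instruction of `C` at `n`. -/
def graph (C : OracleMachine) (body : C.Q → OracleMachine) : OracleMachine where
  Q := Σ n, (body n).Q
  finite_states := by
    have := C.finite_states
    have := fun n => (body n).finite_states
    infer_instance
  start := ⟨C.start, (body C.start).start⟩
  code := fun ⟨n, q⟩ =>
    match (body n).code q with
    | Instr.halt => (C.code n).map fun n' => ⟨n', (body n').start⟩
    | I => I.map fun q' => ⟨n, q'⟩

section graph

variable {C : OracleMachine} {body : C.Q → OracleMachine}

theorem graph_code_of_halt {n : C.Q} {q : (body n).Q} (h : (body n).code q = Instr.halt) :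
    (C.graph body).code ⟨n, q⟩ = (C.code n).map fun n' => ⟨n', (body n').start⟩ := by
  simp [graph, h]

theorem graph_code_of_ne_halt {n : C.Q} {q : (body n).Q} (h : (body n).code q ≠ Instr.halt) :
    (C.graph body).code ⟨n, q⟩ = ((body n).code q).map fun q' => ⟨n, q'⟩ := by
  unfold graph
  dsimp only
  split
  · contradiction
  · rfl

/-- Started in node `n` with store `σ`, the flow chart halts within `t` steps with store `τ`. -/
def GraphExec (C : OracleMachine) (body : C.Q → OracleMachine) (A : Lang) (n : C.Q) (σ : Store)
    (t : ℕ) (τ : Store) : Prop :=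
  ∃ q, (C.graph body).code q = Instr.halt ∧
    ((C.graph body).step A)^[t] ⟨⟨n, (body n).start⟩, σ⟩ = ⟨q, τ⟩

theorem GraphExec.exec {A : Lang} {σ τ : Store} {t : ℕ}
    (h : GraphExec C body A C.start σ t τ) : (C.graph body).Exec A σ t τ := h

theorem GraphExec.mono {A : Lang} {n : C.Q} {σ τ : Store} {t t' : ℕ}
    (h : GraphExec C body A n σ t τ) (htt : t ≤ t') : GraphExec C body A n σ t' τ := by
  obtain ⟨q, hq, h⟩ := h
  obtain ⟨d, rfl⟩ := Nat.exists_eq_add_of_le' htt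
  refine ⟨q, hq, ?_⟩
  rw [Function.iterate_add_apply, h, iterate_step_of_halt hq]

/-- Inside a node, the flow chart follows the computation of the body up to its end. It may get there
in fewer than `t` steps, since it does not wait in the halting state of the body. -/
theorem exists_graph_run_body {A : Lang} {n : C.Q} {t : ℕ} :
    ∀ {q₀ q : (body n).Q} {σ τ : Store}, (body n).code q = Instr.halt →
      ((body n).step A)^[t] ⟨q₀, σ⟩ = ⟨q, τ⟩ →
      ∃ t₀ ≤ t, ∃ q', (body n).code q' = Instr.halt ∧
        ((C.graph body).step A)^[t₀] ⟨⟨n, q₀⟩, σ⟩ = ⟨⟨n, q'⟩, τ⟩ := by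
  induction t with
  | zero =>
    intro q₀ q σ τ hq h
    simp only [Function.iterate_zero, id_eq, Cfg.mk.injEq] at h
    exact ⟨0, le_rfl, q, hq, by simp [h.1, h.2]⟩
  | succ t ih =>
    intro q₀ q σ τ hq h
    by_cases h0 : (body n).code q₀ = Instr.halt
    · rw [iterate_step_of_halt (c := ⟨q₀, σ⟩) h0] at h
      cases h
      exact ⟨0, Nat.zero_le _, q₀, h0, rfl⟩
    · rw [Function.iterate_succ_apply, step_eq] at h
      obtain ⟨t₀, ht, q', hq', h'⟩ := ih hq h
      refine ⟨t₀ + 1, Nat.succ_le_succ ht, q', hq', ?_⟩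
      rw [Function.iterate_succ_apply, ← h', step_eq]
      congr 1
      rw [graph_code_of_ne_halt h0]
      exact Instr.act_map _ A q₀ σ _

theorem GraphExec.halt {A : Lang} {n : C.Q} {σ τ : Store} {t : ℕ}
    (hn : C.code n = Instr.halt) (h : (body n).Exec A σ t τ) : GraphExec C body A n σ t τ := by
  obtain ⟨q, hq, h⟩ := h
  obtain ⟨t₀, ht, q', hq', h'⟩ := exists_graph_run_body (C := C) hq h
  refine GraphExec.mono (t := t₀) ⟨⟨n, q'⟩, ?_, h'⟩ ht
  rw [graph_code_of_halt hq', hn]; rfl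

theorem GraphExec.step {A : Lang} {n n' : C.Q} {σ σ' σ'' τ : Store} {t t' : ℕ}
    (hn : C.code n ≠ Instr.halt) (h : (body n).Exec A σ t σ') (hs : C.step A ⟨n, σ'⟩ = ⟨n', σ''⟩)
    (h' : GraphExec C body A n' σ'' t' τ) : GraphExec C body A n σ (t + 1 + t') τ := by
  obtain ⟨q, hq, h⟩ := h
  obtain ⟨t₀, ht, q₁, hq₁, h₁⟩ := exists_graph_run_body (C := C) hq h
  obtain ⟨q₂, hq₂, h₂⟩ := h'
  refine GraphExec.mono (t := t' + (1 + t₀)) ⟨q₂, hq₂, ?_⟩ (by omega)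
  rw [Function.iterate_add_apply, Function.iterate_add_apply, h₁, Function.iterate_one, ← h₂,
    step_eq, graph_code_of_halt hq₁]
  congr 1
  refine Eq.trans (b := Instr.act A (⟨n, (body n).start⟩ : Σ n, (body n).Q) σ'
    ((C.code n).map fun n' => ⟨n', (body n').start⟩)) ?_ ?_
  · cases hc : C.code n <;> first | contradiction | rfl
  · rw [Instr.act_map (fun n' => (⟨n', (body n').start⟩ : Σ n, (body n).Q)) A n σ' (C.code n)]
    rw [step_eq] at hs
    rw [hs]
    rfl

end graph

open Function (update)

/-! ### Structured programs -/

/-- The machine that halts at once. -/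
def skip : OracleMachine where
  Q := Unit
  finite_states := inferInstance
  start := ()
  code _ := Instr.halt

theorem exec_skip (A : Lang) (σ : Store) : skip.Exec A σ 0 σ := ⟨(), rfl, rfl⟩

/-- Push the bit `b` on stack `i`. -/
def pushBit (i : ℕ) (b : Bool) : OracleMachine where
  Q := Bool
  finite_states := inferInstance
  start := false
  code q := if q then Instr.halt else Instr.push i b true

theorem exec_pushBit (A : Lang) (σ : Store) (i : ℕ) (b : Bool) :
    (pushBit i b).Exec A σ 1 (update σ i (b :: σ i)) := ⟨true, rfl, rfl⟩

/-- Push the answer of the oracle to the query on stack `i` on stack `j`. -/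
def ask (i j : ℕ) : OracleMachine where
  Q := Fin 4
  finite_states := inferInstance
  start := 0
  code := ![Instr.query i 1 2, Instr.push j false 3, Instr.push j true 3, Instr.halt]

theorem exec_ask (A : Lang) (σ : Store) (i j : ℕ) :
    (ask i j).Exec A σ 2 (update σ j (A (σ i) :: σ j)) := by
  refine ⟨(3 : Fin 4), rfl, ?_⟩
  rw [Function.iterate_succ_apply, Function.iterate_one, step_eq, step_eq]
  cases h : A (σ i) <;> simp [ask, Instr.act, h]

/-- The control of `seq`. -/
def seqControl : OracleMachine where
  Q := Bool
  finite_states := inferInstance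
  start := false
  code q := if q then Instr.halt else Instr.goto true

/-- Run `P`, then `P'`. -/
def seq (P P' : OracleMachine) : OracleMachine :=
  graph seqControl fun q : Bool => if q then P' else P

theorem Exec.seq {P P' : OracleMachine} {A : Lang} {σ σ' τ : Store} {t t' : ℕ}
    (h : P.Exec A σ t σ') (h' : P'.Exec A σ' t' τ) : (P.seq P').Exec A σ (t + t' + 1) τ := by
  have h2 : GraphExec seqControl (fun q : Bool => if q then P' else P) A true σ' t' τ :=
    GraphExec.halt rfl h'
  have h1 := GraphExec.step (C := seqControl) (n := false)
    (by simp [seqControl, Instr.goto]) h (step_eq _ _ _ |>.trans (Instr.act_goto A _ _ _)) h2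
  exact (h1.mono (by omega)).exec

/-- The control of `ifPop`. -/
def ifPopControl (i : ℕ) : OracleMachine where
  Q := Fin 5
  finite_states := inferInstance
  start := 0
  code := ![Instr.pop i 1 2 3, Instr.goto 4, Instr.goto 4, Instr.goto 4, Instr.halt]

/-- Pop a bit from stack `i` and continue with `Pe`, `Pf` or `Pt`. -/
def ifPop (i : ℕ) (Pe Pf Pt : OracleMachine) : OracleMachine :=
  graph (ifPopControl i) ![skip, Pe, Pf, Pt, skip]

theorem exec_ifPop {i : ℕ} {Pe Pf Pt : OracleMachine} {A : Lang} {σ τ : Store} {t : ℕ}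
    (he : σ i = [] → Pe.Exec A σ t τ)
    (hf : ∀ w, σ i = false :: w → Pf.Exec A (update σ i w) t τ)
    (ht : ∀ w, σ i = true :: w → Pt.Exec A (update σ i w) t τ) :
    (ifPop i Pe Pf Pt).Exec A σ (t + 3) τ := by
  have last : GraphExec (ifPopControl i) ![skip, Pe, Pf, Pt, skip] A (4 : Fin 5) τ 0 τ :=
    GraphExec.halt rfl (exec_skip A τ)
  rcases h : σ i with _ | ⟨_ | _, w⟩
  · have h1 := GraphExec.step (C := ifPopControl i) (n := (1 : Fin 5))
      (by simp [ifPopControl, Instr.goto]) (he h)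
      (step_eq _ _ _ |>.trans (Instr.act_goto A _ _ _)) last
    have h0 := GraphExec.step (C := ifPopControl i) (n := (0 : Fin 5))
      (by simp [ifPopControl]) (exec_skip A σ)
      (step_eq _ _ _ |>.trans (by simp [ifPopControl, Instr.act, h])) h1
    exact (h0.mono (by omega)).exec
  · have h1 := GraphExec.step (C := ifPopControl i) (n := (2 : Fin 5))
      (by simp [ifPopControl, Instr.goto]) (hf w h)
      (step_eq _ _ _ |>.trans (Instr.act_goto A _ _ _)) last
    have h0 := GraphExec.step (C := ifPopControl i) (n := (0 : Fin 5))
      (by simp [ifPopControl]) (exec_skip A σ)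
      (step_eq _ _ _ |>.trans (by simp [ifPopControl, Instr.act, h])) h1
    exact (h0.mono (by omega)).exec
  · have h1 := GraphExec.step (C := ifPopControl i) (n := (3 : Fin 5))
      (by simp [ifPopControl, Instr.goto]) (ht w h)
      (step_eq _ _ _ |>.trans (Instr.act_goto A _ _ _)) last
    have h0 := GraphExec.step (C := ifPopControl i) (n := (0 : Fin 5))
      (by simp [ifPopControl]) (exec_skip A σ)
      (step_eq _ _ _ |>.trans (by simp [ifPopControl, Instr.act, h])) h1
    exact (h0.mono (by omega)).exec

/-- The control of `whilePop`. -/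
def whilePopControl (i : ℕ) : OracleMachine where
  Q := Fin 4
  finite_states := inferInstance
  start := 0
  code := ![Instr.pop i 3 1 2, Instr.goto 0, Instr.goto 0, Instr.halt]

/-- While stack `i` is not empty, pop a bit `b` from it and run `P b`. -/
def whilePop (i : ℕ) (P : Bool → OracleMachine) : OracleMachine :=
  graph (whilePopControl i) ![skip, P false, P true, skip]

/-- The loop rule; the invariant `I l` speaks about the moment when `l` is left on stack `i`. -/
theorem exec_whilePop {i : ℕ} {P : Bool → OracleMachine} {A : Lang} {t : ℕ}
    (I : List Bool → Store → Prop) (hi : ∀ l σ, I l σ → σ i = l)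
    (hP : ∀ b l σ, I (b :: l) σ → ∃ τ, (P b).Exec A (update σ i l) t τ ∧ I l τ)
    (l : List Bool) (σ : Store) (hl : I l σ) :
    ∃ τ, (whilePop i P).Exec A σ (l.length * (t + 2) + 1) τ ∧ I [] τ := by
  suffices H : ∃ τ, GraphExec (whilePopControl i) ![skip, P false, P true, skip] A (0 : Fin 4) σ
      (l.length * (t + 2) + 1) τ ∧ I [] τ by
    obtain ⟨τ, h, h'⟩ := H
    exact ⟨τ, h.exec, h'⟩
  induction l generalizing σ with
  | nil =>
    have last : GraphExec (whilePopControl i) ![skip, P false, P true, skip] A (3 : Fin 4) σ 0 σ :=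
      GraphExec.halt rfl (exec_skip A σ)
    have h0 := GraphExec.step (C := whilePopControl i) (n := (0 : Fin 4))
      (by simp [whilePopControl]) (exec_skip A σ)
      (step_eq _ _ _ |>.trans (by simp [whilePopControl, Instr.act, hi _ _ hl])) last
    exact ⟨σ, h0.mono (by simp), hl⟩
  | cons b l ih =>
    obtain ⟨σ', h1, h2⟩ := hP b l σ hl
    obtain ⟨τ, h3, h4⟩ := ih σ' h2
    refine ⟨τ, ?_, h4⟩
    have hσ := hi _ _ hl
    have ht : 0 + 1 + (t + 1 + (l.length * (t + 2) + 1)) ≤ (b :: l).length * (t + 2) + 1 := by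
      simp only [List.length_cons]; linarith
    cases b with
    | false =>
      have h1' := GraphExec.step (C := whilePopControl i) (n := (1 : Fin 4))
        (by simp [whilePopControl, Instr.goto]) h1
        (step_eq _ _ _ |>.trans (Instr.act_goto A _ _ _)) h3
      have h0 := GraphExec.step (C := whilePopControl i) (n := (0 : Fin 4))
        (by simp [whilePopControl]) (exec_skip A σ)
        (step_eq _ _ _ |>.trans (by simp [whilePopControl, Instr.act, hσ])) h1'
      exact h0.mono ht
    | true =>
      have h1' := GraphExec.step (C := whilePopControl i) (n := (2 : Fin 4))
        (by simp [whilePopControl, Instr.goto]) h1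
        (step_eq _ _ _ |>.trans (Instr.act_goto A _ _ _)) h3
      have h0 := GraphExec.step (C := whilePopControl i) (n := (0 : Fin 4))
        (by simp [whilePopControl]) (exec_skip A σ)
        (step_eq _ _ _ |>.trans (by simp [whilePopControl, Instr.act, hσ])) h1'
      exact h0.mono ht

/-! ### Moving data between stacks -/

/-- Empty stack `i`. -/
def clear (i : ℕ) : OracleMachine := whilePop i fun _ => skip

theorem exec_clear (A : Lang) (σ : Store) (i : ℕ) :
    (clear i).Exec A σ ((σ i).length * 2 + 1) (update σ i []) := by
  obtain ⟨τ, h, rfl⟩ := exec_whilePop (P := fun _ => skip) (A := A) (t := 0)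
    (fun l τ => τ = update σ i l) (i := i) (by rintro l _ rfl; simp)
    (by rintro b l _ rfl; exact ⟨_, exec_skip A _, by simp⟩) (σ i) σ (by simp)
  exact h

/-- Pop everything from stack `i`, pushing it on stack `j` (so that the order is reversed). -/
def shift (i j : ℕ) : OracleMachine := whilePop i fun b => pushBit j b

theorem exec_shift (A : Lang) (σ : Store) {i j : ℕ} (hij : i ≠ j) :
    (shift i j).Exec A σ ((σ i).length * 3 + 1)
      (update (update σ i []) j ((σ i).reverse ++ σ j)) := by
  obtain ⟨τ, h, h1, h2, h3⟩ := exec_whilePop (P := fun b => pushBit j b) (A := A) (t := 1)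
    (fun l τ => τ i = l ∧ l.reverse ++ τ j = (σ i).reverse ++ σ j ∧
      ∀ k, k ≠ i → k ≠ j → τ k = σ k) (i := i) (fun l τ h => h.1)
    (by
      rintro b l τ ⟨h1, h2, h3⟩
      refine ⟨_, exec_pushBit A _ j b, ?_, ?_, fun k hk hk' => ?_⟩
      · simp [hij]
      · simpa [hij.symm] using h2
      · simp [hk, hk', h3 k hk hk'])
    (σ i) σ ⟨rfl, rfl, fun _ _ _ => rfl⟩
  have : τ = update (update σ i []) j ((σ i).reverse ++ σ j) := by
    funext k
    by_cases hk' : k = j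
    · subst hk'; simpa using h2
    by_cases hk : k = i
    · subst hk; simp [hk', h1]
    · simp [hk, hk', h3 k hk hk']
  rwa [← this]

/-- Like `shift`, but push everything on both stacks `j` and `k`. -/
def shiftTwo (i j k : ℕ) : OracleMachine := whilePop i fun b => (pushBit j b).seq (pushBit k b)

theorem exec_shiftTwo (A : Lang) (σ : Store) {i j k : ℕ} (hij : i ≠ j) (hik : i ≠ k)
    (hjk : j ≠ k) :
    (shiftTwo i j k).Exec A σ ((σ i).length * 5 + 1)
      (update (update (update σ i []) j ((σ i).reverse ++ σ j)) k ((σ i).reverse ++ σ k)) := by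
  obtain ⟨τ, h, h1, h2, h2', h3⟩ := exec_whilePop
    (P := fun b => (pushBit j b).seq (pushBit k b)) (A := A) (t := 3)
    (fun l τ => τ i = l ∧ l.reverse ++ τ j = (σ i).reverse ++ σ j ∧
      l.reverse ++ τ k = (σ i).reverse ++ σ k ∧
      ∀ m, m ≠ i → m ≠ j → m ≠ k → τ m = σ m) (i := i) (fun l τ h => h.1)
    (by
      rintro b l τ ⟨h1, h2, h2', h3⟩
      refine ⟨_, (exec_pushBit A _ j b).seq (exec_pushBit A _ k b), ?_, ?_, ?_,
        fun m hm hm' hm'' => ?_⟩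
      · simp [hij, hik]
      · simpa [hij.symm, hjk] using h2
      · simpa [hik.symm, hjk.symm] using h2'
      · simp [hm, hm', hm'', h3 m hm hm' hm''])
    (σ i) σ ⟨rfl, rfl, rfl, fun _ _ _ _ => rfl⟩
  have : τ = update (update (update σ i []) j ((σ i).reverse ++ σ j)) k
      ((σ i).reverse ++ σ k) := by
    funext m
    by_cases hk : m = k
    · subst hk; simpa using h2'
    by_cases hj : m = j
    · subst hj; simpa [hk] using h2
    by_cases hi : m = i
    · subst hi; simp [hk, hj, h1]
    · simp [hi, hj, hk, h3 m hi hj hk]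
  rwa [← this]

/-- Move the contents of stack `i` on top of stack `j`, using the empty stack `k`. -/
def move (i j k : ℕ) : OracleMachine := (shift i k).seq (shift k j)

theorem exec_move (A : Lang) (σ : Store) {i j k : ℕ} (hij : i ≠ j) (hik : i ≠ k) (hjk : j ≠ k)
    (hk : σ k = []) :
    (move i j k).Exec A σ ((σ i).length * 6 + 3) (update (update σ i []) j (σ i ++ σ j)) := by
  have h := (exec_shift A σ hik).seq (exec_shift A _ hjk.symm)
  refine (congrArg (Exec _ A σ _) ?_).mp (h.mono ?_)
  · funext m
    by_cases hj : m = j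
    · subst hj; simp [hjk, hij.symm, hk]
    by_cases hk' : m = k
    · subst hk'; simp [hik.symm, hjk.symm, hk]
    by_cases hi : m = i
    · subst hi; simp [hij, hik]
    · simp [hi, hj, hk']
  · simp [hk]; omega

/-- Copy the contents of stack `i` on top of stack `j`, using the empty stack `k`. -/
def copy (i j k : ℕ) : OracleMachine := (shift i k).seq (shiftTwo k i j)

theorem exec_copy (A : Lang) (σ : Store) {i j k : ℕ} (hij : i ≠ j) (hik : i ≠ k) (hjk : j ≠ k)
    (hk : σ k = []) :
    (copy i j k).Exec A σ ((σ i).length * 8 + 3) (update σ j (σ i ++ σ j)) := by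
  have h := (exec_shift A σ hik).seq (exec_shiftTwo A _ hik.symm hjk.symm hij)
  refine (congrArg (Exec _ A σ _) ?_).mp (h.mono ?_)
  · funext m
    by_cases hj : m = j
    · subst hj; simp [hjk, hij.symm, hk]
    by_cases hk' : m = k
    · subst hk'; simp [hik.symm, hjk.symm, hk]
    by_cases hi : m = i
    · subst hi; simp [hij, hik, hk]
    · simp [hi, hj, hk']
  · simp [hk]; omega

/-- Empty the stacks `d, …, d + n - 1`. -/
def clearRange (d : ℕ) : ℕ → OracleMachine
  | 0 => skip
  | n + 1 => (clearRange d n).seq (clear (d + n))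

/-- Copy stack `src i` to stack `dst i` for all `i < n`, using the empty stack `k`. -/
def copyRange (src dst : ℕ → ℕ) (k : ℕ) : ℕ → OracleMachine
  | 0 => skip
  | n + 1 => (copyRange src dst k n).seq (copy (src n) (dst n) k)

theorem exec_clearRange (A : Lang) (d n B : ℕ) (σ : Store) (hB : ∀ j, (σ j).length ≤ B) :
    (clearRange d n).Exec A σ (n * (B * 2 + 2))
      (fun j => if d ≤ j ∧ j < d + n then [] else σ j) := by
  induction n with
  | zero =>
    refine (congrArg (Exec _ A σ _) ?_).mp ((exec_skip A σ).mono (Nat.zero_le _))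
    funext j
    rw [if_neg (by omega)]
  | succ n ih =>
    have h := ih.seq (exec_clear A _ (d + n))
    refine (congrArg (Exec _ A σ _) ?_).mp (h.mono ?_)
    · funext j
      rcases eq_or_ne j (d + n) with rfl | hj
      · simp
      · simp only [Function.update_of_ne hj]
        split_ifs <;> first | rfl | omega
    · have := hB (d + n)
      simp only [lt_self_iff_false, and_false, if_false]
      linarith

theorem exec_copyRange (A : Lang) (src dst : ℕ → ℕ) (k n B : ℕ) (σ : Store)
    (hB : ∀ j, (σ j).length ≤ B) (hk : σ k = []) (hdst : ∀ i < n, σ (dst i) = [])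
    (hinj : ∀ i < n, ∀ j < n, dst i = dst j → i = j)
    (h1 : ∀ i < n, ∀ j < n, src i ≠ dst j) (h2 : ∀ i < n, src i ≠ k) (h3 : ∀ i < n, dst i ≠ k) :
    ∃ τ, (copyRange src dst k n).Exec A σ (n * (B * 8 + 4)) τ ∧
      (∀ i < n, τ (dst i) = σ (src i)) ∧ ∀ j, (∀ i < n, j ≠ dst i) → τ j = σ j := by
  induction n with
  | zero => exact ⟨σ, (exec_skip A σ).mono (Nat.zero_le _), by simp, by simp⟩
  | succ n ih =>
    obtain ⟨τ, e, e1, e2⟩ := ih (fun i hi => hdst i (by omega))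
      (fun i hi j hj => hinj i (by omega) j (by omega))
      (fun i hi j hj => h1 i (by omega) j (by omega)) (fun i hi => h2 i (by omega))
      (fun i hi => h3 i (by omega))
    have hτs : τ (src n) = σ (src n) := e2 _ fun i hi => h1 n (by omega) i (by omega)
    have hτd : τ (dst n) = [] := by
      rw [e2, hdst n (by omega)]
      intro i hi h
      have := hinj n (by omega) i (by omega) h
      omega
    have hτk : τ k = [] := by
      rw [e2, hk]
      exact fun i hi => (h3 i (by omega)).symm
    refine ⟨_, (e.seq (exec_copy A τ (h1 n (by omega) n (by omega)) (h2 n (by omega))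
      (h3 n (by omega)) hτk)).mono ?_, ?_, ?_⟩
    · have := hB (src n)
      rw [hτs]
      linarith
    · intro i hi
      rcases eq_or_ne i n with rfl | hin
      · simp [hτs, hτd]
      · rw [Function.update_of_ne, e1 i (by omega)]
        exact fun h => hin (hinj i hi n (by omega) h)
    · intro j hj
      rw [Function.update_of_ne (hj n (by omega)), e2 j fun i hi => hj i (by omega)]

end OracleMachine

open Function (update)
open OracleMachine

/-! ### Polynomial-time oracle functions -/

theorem eval_le_eval (p : Polynomial ℕ) {a b : ℕ} (h : a ≤ b) : p.eval a ≤ p.eval b := by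
  rw [Polynomial.eval_eq_sum, Polynomial.eval_eq_sum]
  exact Finset.sum_le_sum fun i _ => Nat.mul_le_mul_left _ (Nat.pow_le_pow_left h i)

/-- The store that holds the strings `v` on the first stacks. -/
def store {n : ℕ} (v : Fin n → List Bool) : Store := fun i => if h : i < n then v ⟨i, h⟩ else []

/-- The total length of a tuple of strings. -/
def size {n : ℕ} (v : Fin n → List Bool) : ℕ := ∑ i, (v i).length

section store

variable {n : ℕ} (v : Fin n → List Bool)

theorem store_of_lt {i : ℕ} (h : i < n) : store v i = v ⟨i, h⟩ := dif_pos h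

theorem store_of_le {i : ℕ} (h : n ≤ i) : store v i = [] := dif_neg (by omega)

theorem length_le_size (i : Fin n) : (v i).length ≤ size v :=
  Finset.single_le_sum (f := fun i => (v i).length) (fun _ _ => Nat.zero_le _) (Finset.mem_univ i)

theorem length_store_le (i : ℕ) : (store v i).length ≤ size v := by
  by_cases h : i < n
  · rw [store_of_lt v h]; exact length_le_size v _
  · rw [store_of_le v (by omega)]; exact Nat.zero_le _

theorem store_snoc (s : List Bool) :
    store (Fin.snoc v s : Fin (n + 1) → List Bool) = update (store v) n s := by
  funext i
  rcases lt_trichotomy i n with h | rfl | h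
  · rw [store_of_lt _ (by omega), Function.update_of_ne h.ne, store_of_lt v h]
    exact Fin.snoc_castSucc (α := fun _ => List Bool) s v ⟨i, h⟩
  · rw [store_of_lt _ (by omega), Function.update_self]
    exact Fin.snoc_last (α := fun _ => List Bool) s v
  · rw [store_of_le _ (by omega), Function.update_of_ne h.ne', store_of_le v (by omega)]

theorem size_snoc (s : List Bool) :
    size (Fin.snoc v s : Fin (n + 1) → List Bool) = size v + s.length := by
  simp [size, Fin.sum_univ_castSucc]

end store

/-- `FP n f`: the function `f` of an oracle and `n` strings is computed in polynomial time by a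
single machine for all oracles. The machine finds the arguments on the stacks `0, …, n - 1` and
leaves them there, puts the value on stack `n`, and leaves all other stacks empty. -/
def FP (n : ℕ) (f : Lang → (Fin n → List Bool) → List Bool) : Prop :=
  ∃ (M : OracleMachine) (p : Polynomial ℕ), ∀ A v,
    M.Exec A (store v) (p.eval (size v)) (update (store v) n (f A v))

/-- Run a machine as a subroutine, on the stacks `φ 0, φ 1, …`. -/
theorem OracleMachine.Exec.call {M : OracleMachine} {A : Lang} {φ : ℕ → ℕ} {σ : Store} {t n : ℕ}
    {v : Fin n → List Bool} {y : List Bool} (h : M.Exec A (store v) t (update (store v) n y))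
    (hφ : Function.Injective φ) (hσ : σ ∘ φ = store v) :
    (M.reloc φ).Exec A σ t (update σ (φ n) y) := by
  refine Exec.reloc hφ (hσ ▸ h) ?_ ?_
  · rw [Function.update_comp_eq_of_injective _ hφ, hσ]
  · intro j hj
    rw [Function.update_of_ne]
    rintro rfl
    exact hj ⟨n, rfl⟩

/-- Keep the first `n` stacks, and shift the others by `d`. -/
def skipStacks (n d : ℕ) (i : ℕ) : ℕ := if i < n then i else i + d

theorem skipStacks_injective (n d : ℕ) : Function.Injective (skipStacks n d) := by
  intro i j h
  unfold skipStacks at h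
  split_ifs at h <;> omega

namespace FP

variable {n : ℕ}

theorem length_le {f : Lang → (Fin n → List Bool) → List Bool} (hf : FP n f) :
    ∃ p : Polynomial ℕ, ∀ A v, (f A v).length ≤ p.eval (size v) := by
  obtain ⟨M, p, h⟩ := hf
  refine ⟨p, fun A v => ?_⟩
  simpa [store_of_le v le_rfl] using (h A v).length_le n

theorem nil : FP n fun _ _ => [] := by
  refine ⟨skip, 0, fun A v => ?_⟩
  have : update (store v) n [] = store v := by
    rw [← store_of_le v le_rfl, Function.update_eq_self]
  rw [this]
  exact (exec_skip A _).mono (Nat.zero_le _)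

theorem proj (i : Fin n) : FP n fun _ v => v i := by
  refine ⟨copy i n (n + 1), 8 * Polynomial.X + 3, fun A v => ?_⟩
  have h := exec_copy A (store v) (i := i) (j := n) (k := n + 1) (by omega) (by omega) (by omega)
    (store_of_le v (by omega))
  rw [store_of_le v le_rfl, List.append_nil, store_of_lt v i.2] at h
  have := length_le_size v i
  refine h.mono ?_
  simp only [Polynomial.eval_add, Polynomial.eval_mul, Polynomial.eval_X, Polynomial.eval_ofNat]
  simp only [Fin.eta]
  omega

theorem cons (b : Bool) {f : Lang → (Fin n → List Bool) → List Bool} (hf : FP n f) :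
    FP n fun A v => b :: f A v := by
  obtain ⟨M, p, h⟩ := hf
  refine ⟨M.seq (pushBit n b), p + 1 + 1, fun A v => ?_⟩
  simpa using (h A v).seq (exec_pushBit A _ n b)

theorem tail {f : Lang → (Fin n → List Bool) → List Bool} (hf : FP n f) :
    FP n fun A v => (f A v).tail := by
  obtain ⟨M, p, h⟩ := hf
  refine ⟨M.seq (ifPop n skip skip skip), p + 4, fun A v => ?_⟩
  have := (h A v).seq (P' := ifPop n skip skip skip) (t' := 3)
    (τ := update (store v) n (f A v).tail)
    (exec_ifPop (t := 0) (fun h => ?_) (fun w h => ?_) fun w h => ?_)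
  · exact this.mono (by simp)
  · rw [Function.update_self] at h
    simpa [h] using exec_skip A (update (store v) n [])
  · rw [Function.update_self] at h
    simpa [h] using exec_skip A (update (store v) n w)
  · rw [Function.update_self] at h
    simpa [h] using exec_skip A (update (store v) n w)

theorem query {f : Lang → (Fin n → List Bool) → List Bool} (hf : FP n f) :
    FP n fun A v => [A (f A v)] := by
  obtain ⟨M, p, h⟩ := hf
  refine ⟨((M.seq (ask n (n + 1))).seq (clear n)).seq (move (n + 1) n (n + 2)),
    3 * p + 20, fun A v => ?_⟩
  have hlen := (h A v).length_le n
  simp only [Function.update_self, store_of_le v le_rfl, List.length_nil, Nat.zero_add] at hlen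
  have e := (((h A v).seq (exec_ask A _ n (n + 1))).seq (exec_clear A _ n)).seq
    (exec_move A _ (i := n + 1) (j := n) (k := n + 2) (by omega) (by omega) (by omega)
      (by simp [store_of_le v]))
  refine (congrArg (Exec _ A _ _) ?_).mp (e.mono ?_)
  · funext j
    rcases eq_or_ne j n with rfl | hj
    · simp [store_of_le v]
    rcases eq_or_ne j (n + 1) with rfl | hj'
    · simp [store_of_le v]
    · simp [hj, hj']
  · simp [store_of_le v]
    omega

/-- Case distinction on the first bit of the first argument. -/
theorem case_proj : FP 4 fun _ v => match v 0 with
    | [] => v 1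
    | false :: _ => v 2
    | true :: _ => v 3 := by
  refine ⟨ifPop 0 (copy 1 4 5) ((pushBit 0 false).seq (copy 2 4 5))
    ((pushBit 0 true).seq (copy 3 4 5)), 8 * Polynomial.X + 9, fun A v => ?_⟩
  have hl := length_store_le v
  have e1 := exec_copy A (store v) (i := 1) (j := 4) (k := 5) (by omega) (by omega) (by omega)
    (store_of_le v (by omega))
  have e2 := exec_copy A (store v) (i := 2) (j := 4) (k := 5) (by omega) (by omega) (by omega)
    (store_of_le v (by omega))
  have e3 := exec_copy A (store v) (i := 3) (j := 4) (k := 5) (by omega) (by omega) (by omega)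
    (store_of_le v (by omega))
  rw [store_of_le v le_rfl, List.append_nil] at e1 e2 e3
  have h0 : v 0 = store v 0 := (store_of_lt v (by omega)).symm
  have h1 : v 1 = store v 1 := (store_of_lt v (by omega)).symm
  have h2 : v 2 = store v 2 := (store_of_lt v (by omega)).symm
  have h3 : v 3 = store v 3 := (store_of_lt v (by omega)).symm
  beta_reduce
  rw [h0, h1, h2, h3]
  have hrest : ∀ w b, store v 0 = b :: w →
      update (update (store v) 0 w) 0 (b :: update (store v) 0 w 0) = store v := by
    intro w b h
    rw [Function.update_self, Function.update_idem, ← h, Function.update_eq_self]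
  refine (exec_ifPop (t := 8 * size v + 5) (fun h => ?_) (fun w h => ?_) fun w h => ?_).mono
    (by simp)
  · rw [h]
    exact e1.mono (by have := hl 1; omega)
  · rw [h]
    refine ((exec_pushBit A _ 0 false).seq ((congrArg (fun σ => Exec _ A σ _ _) ?_).mpr e2)).mono ?_
    · exact hrest w _ h
    · have := hl 2; omega
  · rw [h]
    refine ((exec_pushBit A _ 0 true).seq ((congrArg (fun σ => Exec _ A σ _ _) ?_).mpr e3)).mono ?_
    · exact hrest w _ h
    · have := hl 3; omega

/-- Run the machines `G 0, …, G (m - 1)` on the same `n` arguments; the values end up on the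
stacks from `n + 1` on. -/
def callAll (n : ℕ) (G : ℕ → OracleMachine) : ℕ → OracleMachine
  | 0 => skip
  | j + 1 => (callAll n G j).seq ((G j).reloc (skipStacks n (1 + j)))

/-- Composition. The values of the inner functions are collected above the arguments, on the stacks
from `n + 1` on, where the outer function is then called. -/
theorem comp {m : ℕ} {f : Lang → (Fin m → List Bool) → List Bool}
    {g : Fin m → Lang → (Fin n → List Bool) → List Bool} (hf : FP m f) (hg : ∀ i, FP n (g i)) :
    FP n fun A v => f A fun i => g i A v := by
  obtain ⟨M, p, h⟩ := hf
  choose N r hN using hg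
  let G : ℕ → OracleMachine := fun j => if hj : j < m then N ⟨j, hj⟩ else skip
  let q : Polynomial ℕ := ∑ i, r i
  have hq : ∀ s, q.eval s = ∑ i, (r i).eval s := fun s => Polynomial.eval_finsetSum _ _ _
  refine ⟨(((callAll n G m).seq (M.reloc (· + (n + 1)))).seq (clearRange (n + 1) m)).seq
    (move (n + 1 + m) n (n + 2 + m)),
    (m : Polynomial ℕ) * (q + 1) + p.comp q +
      (m : Polynomial ℕ) * ((Polynomial.X + q + p.comp q) * 2 + 2) + 6 * p.comp q + 6,
    fun A v => ?_⟩
  set s := size v with hs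
  set w : Fin m → List Bool := fun i => g i A v with hw
  have hlen : ∀ i, (w i).length ≤ (r i).eval s := fun i => by
    simpa [store_of_le v le_rfl] using (hN i A v).length_le n
  have hsize : size w ≤ q.eval s := by
    rw [hq]; exact Finset.sum_le_sum fun i _ => hlen i
  -- the store after `j` calls
  let st : ℕ → Store := fun j i =>
    if i < n then store v i else if n + 1 ≤ i ∧ i < n + 1 + j then store w (i - (n + 1)) else []
  have hcalls : ∀ j ≤ m, (callAll n G j).Exec A (store v) (j * (q.eval s + 1)) (st j) := by
    intro j
    induction j with
    | zero =>
      intro _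
      refine (congrArg (Exec _ A _ _) ?_).mp ((exec_skip A (store v)).mono (Nat.zero_le _))
      funext i
      simp only [st]
      split_ifs
      · rfl
      · omega
      · exact store_of_le v (by omega)
    | succ j ih =>
      intro hj
      have e : (G j).Exec A (store v) (q.eval s) (update (store v) n (store w j)) := by
        simp only [G, dif_pos (show j < m by omega)]
        rw [store_of_lt w (show j < m by omega)]
        refine (hN _ A v).mono ?_
        rw [hq]
        exact Finset.single_le_sum (f := fun i => (r i).eval s) (fun _ _ => Nat.zero_le _)
          (Finset.mem_univ _)
      have hσ : st j ∘ skipStacks n (1 + j) = store v := by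
        funext i
        simp only [st, skipStacks, Function.comp]
        by_cases hi : i < n
        · simp [hi]
        · rw [if_neg hi, if_neg (by omega), if_neg (by omega), store_of_le v (by omega)]
      have e' := (ih (by omega)).seq (e.call (skipStacks_injective n (1 + j)) hσ)
      refine (congrArg (Exec _ A _ _) ?_).mp (e'.mono (by linarith))
      funext i
      have hn : skipStacks n (1 + j) n = n + 1 + j := by simp [skipStacks]; omega
      rw [hn]
      rcases eq_or_ne i (n + 1 + j) with rfl | hi
      · rw [Function.update_self]
        simp only [st]
        rw [if_neg (by omega), if_pos (by omega)]
        congr 1; omega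
      · rw [Function.update_of_ne hi]
        simp only [st]
        split_ifs <;> first | rfl | omega
  have hσ : st m ∘ (· + (n + 1)) = store w := by
    funext i
    simp only [st, Function.comp]
    rw [if_neg (by omega)]
    split_ifs with hi
    · congr 1; omega
    · rw [store_of_le w (by omega)]
  have e1 := (hcalls m le_rfl).seq ((h A w).call (add_left_injective (n + 1)) hσ)
  have hy : (f A w).length ≤ (p.comp q).eval s := by
    have := (h A w).length_le m
    rw [Function.update_self, store_of_le w le_rfl] at this
    rw [Polynomial.eval_comp]
    exact le_trans (by simpa using this) (eval_le_eval p hsize)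
  have hB : ∀ j, (update (st m) (m + (n + 1)) (f A w) j).length ≤
      s + q.eval s + (p.comp q).eval s := by
    intro j
    rcases eq_or_ne j (m + (n + 1)) with rfl | hj
    · rw [Function.update_self]; omega
    · rw [Function.update_of_ne hj]
      have h1 := length_store_le v j
      have h2 := length_store_le w (j - (n + 1))
      simp only [st]
      split_ifs
      · omega
      · omega
      · simp
  have e2 := (e1.seq (exec_clearRange A (n + 1) m _ _ hB)).seq
    (exec_move A _ (i := n + 1 + m) (j := n) (k := n + 2 + m) (by omega) (by omega) (by omega) (by
      rw [if_neg (by omega), Function.update_of_ne (by omega)]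
      simp only [st]
      rw [if_neg (by omega), if_neg (by omega)]))
  have hval : (if n + 1 ≤ n + 1 + m ∧ n + 1 + m < n + 1 + m then [] else
      update (st m) (m + (n + 1)) (f A w) (n + 1 + m)) = f A w := by
    rw [if_neg (by omega), show n + 1 + m = m + (n + 1) by omega, Function.update_self]
  rw [hval] at e2
  refine (congrArg (Exec _ A _ _) ?_).mp (e2.mono ?_)
  · funext i
    rcases eq_or_ne i n with rfl | hi
    · simp only [Function.update_self]
      rw [if_neg (by omega), Function.update_of_ne (by omega)]
      simp only [st]
      rw [if_neg (by omega), if_neg (by omega), List.append_nil]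
    rw [Function.update_of_ne hi, Function.update_of_ne hi]
    rcases eq_or_ne i (n + 1 + m) with rfl | hi'
    · rw [Function.update_self, store_of_le v (by omega)]
    · rw [Function.update_of_ne hi', Function.update_of_ne (by omega)]
      simp only [st]
      split_ifs
      all_goals first | omega | rfl | (rw [store_of_le v (by omega)])
  · have : p.eval (size w) ≤ (p.comp q).eval s := by
      rw [Polynomial.eval_comp]; exact eval_le_eval p hsize
    simp only [Polynomial.eval_add, Polynomial.eval_mul, Polynomial.eval_natCast,
      Polynomial.eval_one, Polynomial.eval_X, Polynomial.eval_ofNat, Nat.cast_id]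
    linarith

/-- Recursion on notation, with a polynomial bound on all intermediate values. -/
theorem fold {l s₀ : Lang → (Fin n → List Bool) → List Bool}
    {g : Bool → Lang → (Fin (n + 1) → List Bool) → List Bool}
    (hl : FP n l) (hs : FP n s₀) (hg : ∀ b, FP (n + 1) (g b))
    (hbound : ∃ Q : Polynomial ℕ, ∀ A v l', l' <+: l A v →
      (l'.foldl (fun s b => g b A (Fin.snoc v s)) (s₀ A v)).length ≤ Q.eval (size v)) :
    FP n fun A v => (l A v).foldl (fun s b => g b A (Fin.snoc v s)) (s₀ A v) := by
  obtain ⟨Ml, pl, hMl⟩ := hl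
  obtain ⟨Ms, ps, hMs⟩ := hs
  choose Mg pg hMg using hg
  obtain ⟨Q, hQ⟩ := hbound
  let W : Polynomial ℕ := (pg false + pg true).comp (Polynomial.X + Q) + 8 * Q + 8
  refine ⟨(((Ml.reloc (skipStacks n 1)).seq (Ms.reloc (skipStacks n 2))).seq
    (whilePop (n + 1) fun b => (((Mg b).reloc (skipStacks n 2)).seq (clear (n + 2))).seq
      (move (n + 3) (n + 2) (n + 4)))).seq (move (n + 2) n (n + 3)),
    pl + ps + pl * (W + 2) + 6 * Q + 10, fun A v => ?_⟩
  set L := l A v with hL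
  set F : List Bool → List Bool := fun l' =>
    l'.foldl (fun s b => g b A (Fin.snoc v s)) (s₀ A v) with hF
  have hFQ : ∀ l', l' <+: L → (F l').length ≤ Q.eval (size v) := fun l' h => hQ A v l' h
  -- `l'` is left of the list, and `s` is the current state
  let st : List Bool → List Bool → Store := fun l' s =>
    update (update (store v) (n + 1) l') (n + 2) s
  have hLlen : L.length ≤ pl.eval (size v) := by
    simpa [store_of_le v le_rfl] using (hMl A v).length_le n
  have e1 := (hMl A v).call (σ := store v) (skipStacks_injective n 1) (by
    funext i
    simp only [Function.comp, skipStacks]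
    split_ifs
    · rfl
    · rw [store_of_le v (by omega), store_of_le v (by omega)])
  have e2 := (hMs A v).call (σ := update (store v) (n + 1) L) (skipStacks_injective n 2) (by
    funext i
    simp only [Function.comp, skipStacks]
    split_ifs
    · rw [Function.update_of_ne (by omega)]
    · rw [Function.update_of_ne (by omega), store_of_le v (by omega), store_of_le v (by omega)])
  have hn1 : skipStacks n 1 n = n + 1 := by simp [skipStacks]
  have hn2 : skipStacks n 2 n = n + 2 := by simp [skipStacks]
  have hn3 : skipStacks n 2 (n + 1) = n + 3 := by simp [skipStacks]
  rw [hn1] at e1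
  rw [hn2] at e2
  obtain ⟨τ, e3, pre, hpre, hτ⟩ := exec_whilePop (A := A) (i := n + 1) (t := W.eval (size v))
    (P := fun b => (((Mg b).reloc (skipStacks n 2)).seq (clear (n + 2))).seq
      (move (n + 3) (n + 2) (n + 4)))
    (fun l' σ => ∃ pre, pre ++ l' = L ∧ σ = st l' (F pre))
    (by rintro l' _ ⟨pre, -, rfl⟩; simp [st])
    (by
      rintro b l' _ ⟨pre, hpre, rfl⟩
      have hs1 : (F pre).length ≤ Q.eval (size v) := hFQ _ ⟨_, hpre⟩
      have hs2 : (F (pre ++ [b])).length ≤ Q.eval (size v) := hFQ _ ⟨l', by simpa using hpre⟩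
      have hstep : F (pre ++ [b]) = g b A (Fin.snoc v (F pre)) := by simp [hF]
      have hst : update (st (b :: l') (F pre)) (n + 1) l' = st l' (F pre) := by
        simp only [st]
        rw [Function.update_comm (by omega), Function.update_idem]
      have c1 := (hMg b A (Fin.snoc v (F pre))).call (σ := st l' (F pre))
        (skipStacks_injective n 2) (by
          rw [store_snoc]
          funext i
          simp only [Function.comp, skipStacks, st]
          rcases lt_trichotomy i n with h | rfl | h
          · rw [if_pos h, Function.update_of_ne (by omega), Function.update_of_ne (by omega),
              Function.update_of_ne (by omega)]
          · rw [if_neg (by omega), Function.update_self, Function.update_self]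
          · rw [if_neg (by omega), Function.update_of_ne (by omega),
              Function.update_of_ne (by omega), Function.update_of_ne (by omega),
              store_of_le v (by omega), store_of_le v (by omega)])
      rw [hn3] at c1
      have c2 := (c1.seq (exec_clear A _ (n + 2))).seq
        (exec_move A _ (i := n + 3) (j := n + 2) (k := n + 4) (by omega) (by omega) (by omega)
          (by simp [st, store_of_le v]))
      refine ⟨st l' (F (pre ++ [b])), ?_, pre ++ [b], by simpa using hpre, rfl⟩
      rw [hst]
      refine (congrArg (Exec _ A _ _) ?_).mp (c2.mono ?_)
      · rw [hstep]
        funext i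
        rcases eq_or_ne i (n + 2) with rfl | h2
        · simp [st]
        rcases eq_or_ne i (n + 3) with rfl | h3
        · simp [st, store_of_le v]
        · simp [st, h2, h3]
      · have hpg : (pg b).eval (size (Fin.snoc v (F pre) : Fin (n + 1) → List Bool)) ≤
            ((pg false + pg true).comp (Polynomial.X + Q)).eval (size v) := by
          rw [size_snoc, Polynomial.eval_comp]
          simp only [Polynomial.eval_add, Polynomial.eval_X]
          have := eval_le_eval (pg b) (Nat.add_le_add_left hs1 (size v))
          cases b
          · exact this.trans (Nat.le_add_right _ _)
          · exact this.trans (Nat.le_add_left _ _)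
        rw [hstep] at hs2
        simp [st, W, -Polynomial.add_comp] at hpg hs1 hs2 ⊢
        omega)
    L (st L (F [])) ⟨[], rfl, rfl⟩
  have hpre' : pre = L := by simpa using hpre
  subst hτ
  rw [hpre'] at e3
  have e4 := ((e1.seq e2).seq e3).seq
    (exec_move A _ (i := n + 2) (j := n) (k := n + 3) (by omega) (by omega) (by omega)
      (by simp [st, store_of_le v]))
  refine (congrArg (Exec _ A _ _) ?_).mp (e4.mono ?_)
  · funext i
    rcases eq_or_ne i n with rfl | h0
    · simp [st, store_of_le v, hF, hL]
    rcases eq_or_ne i (n + 1) with rfl | h1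
    · simp [st, store_of_le v]
    rcases eq_or_ne i (n + 2) with rfl | h2
    · simp [st, store_of_le v]
    · simp [st, h0, h1, h2]
  · have h1 : L.length * (W.eval (size v) + 2) ≤ pl.eval (size v) * (W.eval (size v) + 2) :=
      Nat.mul_le_mul_right _ hLlen
    have h2 := hFQ L List.prefix_rfl
    simp only [st, Function.update_self, Polynomial.eval_add, Polynomial.eval_mul,
      Polynomial.eval_ofNat]
    omega

end FP

/-! ### Machines as subroutines with a substituted oracle -/

/-- The machine `M` uses only the first `D` stacks. -/
theorem OracleMachine.exists_stack_bound (M : OracleMachine) :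
    ∃ D, ∀ A c t j, D ≤ j → ((M.step A)^[t] c).stack j = c.stack j := by
  have := M.finite_states
  have := Fintype.ofFinite M.Q
  let ix : Instr M.Q → ℕ := fun I => match I with
    | Instr.push i _ _ => i
    | Instr.pop i _ _ _ => i
    | _ => 0
  refine ⟨Finset.univ.sup (fun q => ix (M.code q)) + 1, fun A c t j hj => ?_⟩
  induction t with
  | zero => rfl
  | succ t ih =>
    rw [Function.iterate_succ_apply', ← ih, step_eq]
    set d := (M.step A)^[t] c
    have hd : ix (M.code d.state) ≤ Finset.univ.sup (fun q => ix (M.code q)) :=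
      Finset.le_sup (f := fun q => ix (M.code q)) (Finset.mem_univ _)
    have hne : j ≠ ix (M.code d.state) := by omega
    cases hc : M.code d.state with
    | push i b q =>
      rw [hc] at hne
      simp only [Instr.act]
      rw [Function.update_of_ne hne]
    | pop i qe qf qt =>
      rw [hc] at hne
      simp only [Instr.act]
      rcases d.stack i with _ | ⟨_ | _, w⟩
      · rfl
      · exact Function.update_of_ne hne _ _
      · exact Function.update_of_ne hne _ _
    | query i qf qt => rfl
    | halt => rfl

/-- The control flow of the machine `M` whose stack `i` is stack `φ i`, with every query replaced by
a branch on the bit on top of stack `r`. -/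
def OracleMachine.popControl (M : OracleMachine) (φ : ℕ → ℕ) (r : ℕ) : OracleMachine where
  Q := M.Q
  finite_states := M.finite_states
  start := M.start
  code q := match M.code q with
    | Instr.query _ qf qt => Instr.pop r qf qf qt
    | I => I.reindex φ

/-- The part of the stacks on which a simulated machine lives. -/
def innerStack (n i : ℕ) : ℕ := n + 1 + 2 * i

/-- The stacks of the subroutine that answers the queries of a simulated machine. -/
def handlerStack (n i : ℕ) : ℕ := if i < n then i else n + 2 + 2 * (i - n)

theorem innerStack_injective (n : ℕ) : Function.Injective (innerStack n) := by
  intro i j h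
  unfold innerStack at h
  omega

theorem handlerStack_injective (n : ℕ) : Function.Injective (handlerStack n) := by
  intro i j h
  unfold handlerStack at h
  split_ifs at h <;> omega

theorem handlerStack_ne_innerStack (n i j : ℕ) : handlerStack n i ≠ innerStack n j := by
  unfold handlerStack innerStack
  split_ifs <;> omega

/-- What has to be done before an instruction of a simulated machine is executed: a query is
answered by calling `H`. -/
def OracleMachine.answerQuery (M : OracleMachine) (n : ℕ) (H : OracleMachine) (q : M.Q) :
    OracleMachine :=
  match M.code q with
  | Instr.query i _ _ => ((copy (innerStack n i) (n + 2) (n + 4)).seq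
      (H.reloc (handlerStack n))).seq (clear (n + 2))
  | _ => skip

/-- The simulation of a configuration `c`: the stacks of `c` are inner stacks, and the other
stacks are those of the store `ρ`. -/
def Simulates {Q : Type} (n : ℕ) (ρ : Store) (c : Cfg Q) (σ : Store) : Prop :=
  σ ∘ innerStack n = c.stack ∧ ∀ j, j ∉ Set.range (innerStack n) → σ j = ρ j

theorem OracleMachine.exec_answerQuery {M : OracleMachine} {n : ℕ} {H : OracleMachine}
    {p : Polynomial ℕ} {A : Lang} {v : Fin n → List Bool} {B : Lang}
    (hH : ∀ q, H.Exec A (store (Fin.snoc v q : Fin (n + 1) → List Bool))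
      (p.eval (size (Fin.snoc v q : Fin (n + 1) → List Bool)))
      (update (store (Fin.snoc v q : Fin (n + 1) → List Bool)) (n + 1) [B q]))
    {s : M.Q} {i : ℕ} {qf qt : M.Q} (hs : M.code s = Instr.query i qf qt) {σ : Store}
    (hσ : ∀ j, j ∉ Set.range (innerStack n) → σ j = store v j) :
    (M.answerQuery n H s).Exec A σ
      (p.eval (size v + (σ (innerStack n i)).length) + 10 * (σ (innerStack n i)).length + 6)
      (update σ (n + 4) [B (σ (innerStack n i))]) := by
  have hr : ∀ j, handlerStack n j ∉ Set.range (innerStack n) := by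
    rintro j ⟨k, hk⟩
    exact handlerStack_ne_innerStack n j k hk.symm
  have h2 : handlerStack n n = n + 2 := by simp [handlerStack]
  have h4 : handlerStack n (n + 1) = n + 4 := by simp [handlerStack]
  have hσ2 : σ (n + 2) = [] := by rw [← h2, hσ _ (hr n), store_of_le v (by omega)]
  have hσ4 : σ (n + 4) = [] := by rw [← h4, hσ _ (hr _), store_of_le v (by omega)]
  set q := σ (innerStack n i) with hq
  have e1 := exec_copy A σ (i := innerStack n i) (j := n + 2) (k := n + 4)
    (by rw [← h2]; exact (handlerStack_ne_innerStack n n i).symm)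
    (by rw [← h4]; exact (handlerStack_ne_innerStack n _ i).symm) (by omega) hσ4
  rw [← hq, hσ2, List.append_nil] at e1
  have e2 := (hH q).call (σ := update σ (n + 2) q) (handlerStack_injective n) (by
    rw [store_snoc]
    funext j
    rcases eq_or_ne j n with rfl | hj
    · simp [h2]
    · have : handlerStack n j ≠ n + 2 := by
        rw [← h2]; exact (handlerStack_injective n).ne hj
      rw [Function.comp, Function.update_of_ne this, Function.update_of_ne hj, hσ _ (hr j)]
      unfold handlerStack
      split_ifs with h
      · rfl
      · rw [store_of_le v (by omega), store_of_le v (by omega)])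
  rw [h4, size_snoc] at e2
  have e3 := (e1.seq e2).seq (exec_clear A _ (n + 2))
  unfold answerQuery
  rw [hs]
  refine (congrArg (Exec _ A _ _) ?_).mp (e3.mono ?_)
  · funext j
    rcases eq_or_ne j (n + 4) with rfl | h4'
    · simp
    rcases eq_or_ne j (n + 2) with rfl | h2'
    · simp [hσ2]
    · simp [h4', h2']
  · simp
    omega

/-- The flow chart simulates `t` steps of `M` with the oracle `B`, if `H` computes `B`; the stacks of
`M` have length at most `b` throughout. -/
theorem OracleMachine.graphExec_answerQuery {M : OracleMachine} {n : ℕ} {H : OracleMachine}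
    {p : Polynomial ℕ} {A : Lang} {v : Fin n → List Bool} {B : Lang}
    (hH : ∀ q, H.Exec A (store (Fin.snoc v q : Fin (n + 1) → List Bool))
      (p.eval (size (Fin.snoc v q : Fin (n + 1) → List Bool)))
      (update (store (Fin.snoc v q : Fin (n + 1) → List Bool)) (n + 1) [B q]))
    (b t : ℕ) (c : Cfg M.Q) (σ : Store) (hσ : Simulates n (store v) c σ)
    (hb : ∀ k ≤ t, ∀ j, (((M.step B)^[k] c).stack j).length ≤ b)
    (ht : M.code ((M.step B)^[t] c).state = Instr.halt) :
    ∃ τ, GraphExec (M.popControl (innerStack n) (n + 4)) (M.answerQuery n H) A c.state σ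
        (t * (p.eval (size v + b) + 10 * b + 7)) τ ∧
      Simulates n (store v) ((M.step B)^[t] c) τ := by
  induction t generalizing c σ with
  | zero =>
    refine ⟨σ, ?_, hσ⟩
    rw [Function.iterate_zero, id] at ht
    refine (GraphExec.halt (t := 0) (by simp [popControl, ht, Instr.reindex]) ?_).mono (by simp)
    simp only [answerQuery, ht]
    exact exec_skip A σ
  | succ t ih =>
    by_cases hc : M.code c.state = Instr.halt
    · obtain ⟨τ, h1, h2⟩ := ih c σ hσ (fun k hk => hb k (by omega))
        (by rwa [iterate_step_of_halt hc])
      rw [iterate_step_of_halt hc] at h2 ⊢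
      exact ⟨τ, h1.mono (Nat.mul_le_mul_right _ (Nat.le_succ t)), h2⟩
    · rw [Function.iterate_succ_apply] at ht
      -- the store `σ'` after the query has been answered, and after the instruction, `σ''`
      obtain ⟨σ', σ'', h1, h2, h3⟩ : ∃ σ' σ'',
          (M.answerQuery n H c.state).Exec A σ (p.eval (size v + b) + 10 * b + 6) σ' ∧
          (M.popControl (innerStack n) (n + 4)).step A ⟨c.state, σ'⟩ =
            ⟨(M.step B c).state, σ''⟩ ∧ Simulates n (store v) (M.step B c) σ'' := by
        by_cases hq : ∃ i qf qt, M.code c.state = Instr.query i qf qt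
        · obtain ⟨i, qf, qt, hq⟩ := hq
          have e := exec_answerQuery hH hq hσ.2
          have hi : σ (innerStack n i) = c.stack i := congrFun hσ.1 i
          have hr : n + 4 ∉ Set.range (innerStack n) := by
            rintro ⟨k, hk⟩
            unfold innerStack at hk
            omega
          have h4 : σ (n + 4) = [] := by rw [hσ.2 _ hr, store_of_le v (by omega)]
          rw [hi] at e
          have hbi : (c.stack i).length ≤ b := hb 0 (by omega) i
          refine ⟨_, σ, e.mono ?_, ?_, ?_⟩
          · have := eval_le_eval p (Nat.add_le_add_left hbi (size v))
            omega
          · rw [step_eq, step_eq, hq]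
            simp only [popControl, hq]
            have hu : update (update σ (n + 4) [B (c.stack i)]) (n + 4) [] = σ := by
              rw [Function.update_idem, ← h4, Function.update_eq_self]
            cases hB : B (c.stack i) <;> rw [hB] at hu <;> simp [Instr.act, hB, ← h4]
          · rw [step_eq, hq]
            exact hσ
        · have hcode : (M.popControl (innerStack n) (n + 4)).code c.state =
              (M.code c.state).reindex (innerStack n) := by
            simp only [popControl]
            split
            · rename_i hh; exact absurd ⟨_, _, _, hh⟩ hq
            · rfl
          have hans : M.answerQuery n H c.state = skip := by
            simp only [answerQuery]
            split
            · rename_i hh; exact absurd ⟨_, _, _, hh⟩ hq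
            · rfl
          have hact := act_reindex (innerStack_injective n) A c.state σ (M.code c.state)
          have hB : M.step B c = Instr.act A c.state (σ ∘ innerStack n) (M.code c.state) := by
            rw [step_eq, hσ.1]
            cases hI : M.code c.state with
            | query i qf qt => exact absurd ⟨_, _, _, hI⟩ hq
            | push i b q => rfl
            | pop i qe qf qt => rfl
            | halt => rfl
          refine ⟨σ, (Instr.act A c.state σ ((M.code c.state).reindex (innerStack n))).stack,
            ?_, (step_eq _ _ _).trans ?_, ?_⟩
          · rw [hans]
            exact (exec_skip A σ).mono (Nat.zero_le _)
          · simp only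
            rw [hcode, hB, ← hact.1]
            rfl
          · rw [hB]
            exact ⟨hact.2.1, fun j hj => (hact.2.2 j hj).trans (hσ.2 j hj)⟩
      obtain ⟨τ, h4, h5⟩ := ih (M.step B c) σ'' h3
        (fun k hk j => by simpa using hb (k + 1) (by omega) j) ht
      refine ⟨τ, (GraphExec.step (C := M.popControl (innerStack n) (n + 4)) ?_ h1 h2 h4).mono
        (le_of_eq (by ring)), h5⟩
      intro hh
      simp only [popControl] at hh
      split at hh
      · cases hh
      · cases hI : M.code c.state <;> rw [hI] at hh hc <;> simp [Instr.reindex] at hh hc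

namespace FP

variable {n : ℕ}

/-- A function computed by a polynomial-time oracle machine that is given an oracle in `FP`. -/
theorem of_machine {M : OracleMachine} {k : ℕ} (hM : M.PolyTime k) (e : Fin k → Fin n)
    {B : Lang → (Fin (n + 1) → List Bool) → Bool} (hB : FP (n + 1) fun A w => [B A w])
    {f : Lang → (Fin n → List Bool) → List Bool}
    (hf : ∀ A v, M.Outputs (fun q => B A (Fin.snoc v q)) (List.ofFn fun i => v (e i)) (f A v)) :
    FP n f := by
  obtain ⟨p, hp⟩ := hM
  obtain ⟨H, r, hH⟩ := hB
  obtain ⟨D, hD⟩ := M.exists_stack_bound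
  let src : ℕ → ℕ := fun i => if h : i < k then e ⟨i, h⟩ else 0
  have hsrc : ∀ i < k, src i < n := fun i hi => by simp [src, hi]
  let T : Polynomial ℕ := p.comp ((k : Polynomial ℕ) * Polynomial.X)
  let b : Polynomial ℕ := Polynomial.X + T
  refine ⟨(((copyRange src (innerStack n) (n + 2) k).seq
    (graph (M.popControl (innerStack n) (n + 4)) (M.answerQuery n H))).seq
    (move (n + 1) n (n + 2))).seq (clearRange (n + 1) (2 * (D + k + 1))),
    (k : Polynomial ℕ) * (8 * Polynomial.X + 4) + T * (r.comp (Polynomial.X + b) + 10 * b + 7) +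
      6 * b + (2 * ((D : Polynomial ℕ) + (k : Polynomial ℕ) + 1)) * (b * 2 + 2) + 6, fun A v => ?_⟩
  set O : Lang := fun q => B A (Fin.snoc v q)
  set w : List (List Bool) := List.ofFn fun i => v (e i) with hw
  have hinner : ∀ i, n + 1 ≤ innerStack n i := fun i => by unfold innerStack; omega
  obtain ⟨σ, e1, h1, h2⟩ := exec_copyRange A src (innerStack n) (n + 2) k (size v) (store v)
    (length_store_le v) (store_of_le v (by omega))
    (fun i _ => store_of_le v (by have := hinner i; omega))
    (fun i _ j _ h => innerStack_injective n h)
    (fun i hi j _ h => by have := hsrc i hi; have := hinner j; omega)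
    (fun i hi h => by have := hsrc i hi; omega)
    (fun i _ h => by unfold innerStack at h; omega)
  have hinit : ∀ i, (M.init w).stack i = if h : i < k then v (e ⟨i, h⟩) else [] := by
    intro i
    simp only [OracleMachine.init, hw, List.getD_eq_getElem?_getD]
    rw [List.getElem?_ofFn]
    by_cases h : i < k <;> simp [h]
  have hsim : Simulates n (store v) (M.init w) σ := by
    refine ⟨funext fun i => ?_, fun j hj => h2 j fun i _ h => hj ⟨i, h.symm⟩⟩
    rw [hinit, Function.comp]
    by_cases h : i < k
    · rw [h1 i h, dif_pos h]
      simp only [src, dif_pos h]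
      rw [store_of_lt v (e ⟨i, h⟩).2]
    · rw [h2, store_of_le v (by have := hinner i; omega), dif_neg h]
      intro j hj hij
      have := innerStack_injective n hij
      omega
  -- enough time for the simulated machine
  set t := T.eval (size v) with ht
  have hhalt : M.HaltsWithin O w t := by
    have hle : (w.map List.length).sum ≤ k * size v := by
      have h1 : (w.map List.length).sum = ∑ i, (v (e i)).length := by
        rw [hw, List.map_ofFn, List.sum_ofFn]; rfl
      rw [h1]
      calc _ ≤ ∑ _i : Fin k, size v := Finset.sum_le_sum fun i _ => length_le_size v _
        _ = k * size v := by simp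
    have hp' := hp O w (by simp [hw])
    have hle' : p.eval (w.map List.length).sum ≤ t := by
      simpa [ht, T] using eval_le_eval p hle
    have := hp'.run_eq hle'
    unfold HaltsWithin at hp' ⊢
    rwa [this]
  have hlen : ∀ j, ∀ s ≤ t, (((M.step O)^[s] (M.init w)).stack j).length ≤ size v + t := by
    intro j s hs
    have h3 := M.length_iterate_le O (M.init w) s j
    have h4 : ((M.init w).stack j).length ≤ size v := by
      rw [hinit]
      split_ifs
      · exact length_le_size v _
      · exact Nat.zero_le _
    omega
  obtain ⟨τ, e2, hτ⟩ := graphExec_answerQuery (hH := fun q => hH A (Fin.snoc v q))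
    (b := size v + t) (t := t) (c := M.init w) (B := O) (σ := σ) hsim
    (fun s hs j => hlen j s hs) hhalt
  have hτ0 : τ (n + 1) = f A v := by
    have := congrFun hτ.1 0
    simp only [Function.comp, innerStack, Nat.mul_zero, Nat.add_zero] at this
    rw [this]
    exact (hhalt.outputs_iff _).mp (hf A v)
  have hτin : ∀ i, τ (innerStack n i) = ((M.step O)^[t] (M.init w)).stack i := congrFun hτ.1
  have hτout : ∀ j, (∀ i, j ≠ innerStack n i) → τ j = store v j :=
    fun j hj => hτ.2 j (by rintro ⟨i, rfl⟩; exact hj i rfl)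
  have hτB : ∀ j, (τ j).length ≤ size v + t := by
    intro j
    by_cases hj : ∃ i, j = innerStack n i
    · obtain ⟨i, rfl⟩ := hj
      rw [hτin]
      exact hlen i t le_rfl
    · rw [hτout j fun i hi => hj ⟨i, hi⟩]
      exact (length_store_le v j).trans (Nat.le_add_right _ _)
  have hτn : ∀ j, j ≤ n → τ j = store v j := fun j hj => hτout j fun i hi => by
    have := hinner i; omega
  have e3 := ((e1.seq e2.exec).seq (exec_move A τ (i := n + 1) (j := n) (k := n + 2) (by omega)
    (by omega) (by omega) (by
      rw [hτout, store_of_le v (by omega)]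
      intro i hi
      unfold innerStack at hi
      omega))).seq (exec_clearRange A (n + 1) (2 * (D + k + 1)) (size v + t) _ (fun j => by
        rw [hτn n le_rfl, store_of_le v le_rfl, List.append_nil]
        rcases eq_or_ne j n with rfl | hj
        · rw [Function.update_self]; exact hτB _
        rcases eq_or_ne j (n + 1) with rfl | hj'
        · rw [Function.update_of_ne hj, Function.update_self]; exact Nat.zero_le _
        · rw [Function.update_of_ne hj, Function.update_of_ne hj']; exact hτB _))
  refine (congrArg (Exec _ A _ _) ?_).mp (e3.mono ?_)
  · funext j
    rw [hτn n le_rfl, store_of_le v le_rfl, List.append_nil, hτ0]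
    rcases eq_or_ne j n with rfl | hj
    · rw [if_neg (by omega), Function.update_self, Function.update_self]
    rw [Function.update_of_ne hj, Function.update_of_ne hj]
    split_ifs with hr
    · rw [store_of_le v (by omega)]
    · rw [Function.update_of_ne (by omega)]
      by_cases hj' : ∃ i, j = innerStack n i
      · obtain ⟨i, rfl⟩ := hj'
        have hi : D + k ≤ i := by
          have := hinner i
          unfold innerStack at hr
          omega
        rw [hτin, hD _ _ _ _ (by omega), hinit, dif_neg (by omega),
          store_of_le v (by have := hinner i; omega)]
      · exact hτout j fun i hi => hj' ⟨i, hi⟩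
  · have hτ1 := hτB (n + 1)
    simp only [Polynomial.eval_add, Polynomial.eval_mul, Polynomial.eval_natCast,
      Polynomial.eval_X, Polynomial.eval_ofNat, Polynomial.eval_one, Nat.cast_id,
      Polynomial.eval_comp, b, ← ht]
    linarith

/-- Functions in `FP` are computed by polynomial-time machines. -/
theorem exists_machine (hn : 0 < n) {f : Lang → (Fin n → List Bool) → List Bool} (hf : FP n f) :
    ∃ M : OracleMachine, M.PolyTime n ∧ ∀ A v, M.Outputs A (List.ofFn v) (f A v) := by
  obtain ⟨M, p, h⟩ := hf
  have hinit : ∀ v : Fin n → List Bool, (fun i => (List.ofFn v).getD i []) = store v := by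
    intro v
    funext i
    simp only [List.getD_eq_getElem?_getD]
    rw [List.getElem?_ofFn]
    by_cases h : i < n <;> simp [h, store]
  let P : Polynomial ℕ := p + (n : Polynomial ℕ) * ((Polynomial.X + p) * 2 + 2) + 6 * p + 5
  have key : ∀ A v, ∃ τ : Store, τ 0 = f A v ∧
      ((M.seq (clearRange 0 n)).seq (move n 0 (n + 1))).Exec A
        (fun i => (List.ofFn v).getD i []) (P.eval (size v)) τ := by
    intro A v
    have hy : (f A v).length ≤ p.eval (size v) := by
      simpa [store_of_le v le_rfl] using (h A v).length_le n
    have e := ((h A v).seq (exec_clearRange A 0 n (size v + p.eval (size v)) _ (fun j => by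
      rcases eq_or_ne j n with rfl | hj
      · rw [Function.update_self]; omega
      · rw [Function.update_of_ne hj]
        exact (length_store_le v j).trans (Nat.le_add_right _ _)))).seq
      (exec_move A _ (i := n) (j := 0) (k := n + 1) (by omega) (by omega) (by omega) (by
        rw [if_neg (by omega), Function.update_of_ne (by omega), store_of_le v (by omega)]))
    rw [hinit]
    refine ⟨_, ?_, e.mono ?_⟩
    · rw [Function.update_self, if_neg (by omega), if_pos (by omega), Function.update_self,
        List.append_nil]
    · rw [if_neg (by omega), Function.update_self]
      simp only [Polynomial.eval_add, Polynomial.eval_mul, Polynomial.eval_natCast,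
        Polynomial.eval_X, Polynomial.eval_ofNat, Nat.cast_id, P]
      linarith
  refine ⟨(M.seq (clearRange 0 n)).seq (move n 0 (n + 1)), ⟨P, fun A w hw => ?_⟩, fun A v => ?_⟩
  · subst hw
    obtain ⟨τ, -, h2⟩ := key A w.get
    have h3 : size w.get = (w.map List.length).sum := by
      rw [size, ← List.sum_ofFn]
      congr 1
      conv_rhs => rw [← List.ofFn_get w, List.map_ofFn]
      rfl
    rw [h3, List.ofFn_get] at h2
    exact h2.haltsWithin
  · obtain ⟨τ, h1, h2⟩ := key A v
    rw [← h1]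
    exact h2.outputs

end FP

/-- The successor of a string in the enumeration by length. This is the successor function of
dyadic notation with digits `1`, `2` (written `false`, `true`), the least significant digit first. -/
def succString : List Bool → List Bool
  | [] => [false]
  | false :: w => true :: w
  | true :: w => false :: succString w

/-- The `k`-th string. -/
def nthString (k : ℕ) : List Bool := succString^[k] []

theorem length_succString_le (w : List Bool) : (succString w).length ≤ w.length + 1 := by
  induction w with
  | nil => simp [succString]
  | cons b w ih => cases b <;> simp [succString, ih]

theorem nthString_double (k : ℕ) : nthString (2 * k + 1) = false :: nthString k ∧
    nthString (2 * k + 2) = true :: nthString k := by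
  have hs : ∀ m, nthString (m + 1) = succString (nthString m) :=
    fun m => Function.iterate_succ_apply' _ _ _
  induction k with
  | zero => exact ⟨rfl, rfl⟩
  | succ k ih =>
    have h1 : nthString (2 * (k + 1) + 1) = false :: nthString (k + 1) := by
      rw [show 2 * (k + 1) + 1 = 2 * k + 2 + 1 by ring, hs, ih.2, hs]
      rfl
    refine ⟨h1, ?_⟩
    rw [hs (2 * (k + 1) + 1), h1]
    rfl

/-- Every string of length at most `l` is among the first `2 ^ (l + 1)` strings. -/
theorem exists_nthString_eq (w : List Bool) : ∃ k, k + 1 < 2 ^ (w.length + 1) ∧ nthString k = w := by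
  induction w with
  | nil => exact ⟨0, by simp, rfl⟩
  | cons b w ih =>
    obtain ⟨k, hk, rfl⟩ := ih
    cases b with
    | false =>
      refine ⟨2 * k + 1, ?_, (nthString_double k).1⟩
      rw [List.length_cons, pow_succ]
      omega
    | true =>
      refine ⟨2 * k + 2, ?_, (nthString_double k).2⟩
      rw [List.length_cons, pow_succ]
      omega

namespace FP

variable {n : ℕ} {f g h k : Lang → (Fin n → List Bool) → List Bool}

/-! ### A library of polynomial-time functions -/

theorem comp₂ {F : Lang → (Fin 2 → List Bool) → List Bool} (hF : FP 2 F) (hf : FP n f)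
    (hg : FP n g) : FP n fun A v => F A ![f A v, g A v] := by
  have := comp hF (g := ![f, g]) (by simp [Fin.forall_fin_succ, hf, hg])
  convert this using 4 with A v
  funext i
  fin_cases i <;> rfl

theorem comp₃ {F : Lang → (Fin 3 → List Bool) → List Bool} (hF : FP 3 F) (hf : FP n f)
    (hg : FP n g) (hh : FP n h) : FP n fun A v => F A ![f A v, g A v, h A v] := by
  have := comp hF (g := ![f, g, h]) (by simp [Fin.forall_fin_succ, hf, hg, hh])
  convert this using 4 with A v
  funext i
  fin_cases i <;> rfl

theorem comp₄ {F : Lang → (Fin 4 → List Bool) → List Bool} (hF : FP 4 F) (hf : FP n f)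
    (hg : FP n g) (hh : FP n h) (hk : FP n k) :
    FP n fun A v => F A ![f A v, g A v, h A v, k A v] := by
  have := comp hF (g := ![f, g, h, k]) (by simp [Fin.forall_fin_succ, hf, hg, hh, hk])
  convert this using 4 with A v
  funext i
  fin_cases i <;> rfl

theorem case (hf : FP n f) (hg : FP n g) (hh : FP n h) (hk : FP n k) :
    FP n fun A v => match f A v with
      | [] => g A v
      | false :: _ => h A v
      | true :: _ => k A v :=
  comp₄ case_proj hf hg hh hk

theorem const (w : List Bool) : FP n fun _ _ => w := by
  induction w with
  | nil => exact nil
  | cons b w ih => exact ih.cons b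

/-- Add an unused last argument. -/
theorem weaken (hf : FP n f) : FP (n + 1) fun A w => f A (Fin.init w) :=
  comp hf (g := fun i _ w => w i.castSucc) fun i => proj i.castSucc

theorem last : FP (n + 1) fun _ w => w (Fin.last n) := proj (Fin.last n)

/-- Recursion on notation for a step function that makes strings only slightly longer. -/
theorem foldl {step : Bool → Lang → (Fin n → List Bool) → List Bool → List Bool}
    (hf : FP n f) (hg : FP n g)
    (hstep : ∀ b, FP (n + 1) fun A w => step b A (Fin.init w) (w (Fin.last n)))
    (r : Polynomial ℕ)
    (hr : ∀ b A v s, (step b A v s).length ≤ s.length + r.eval (size v)) :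
    FP n fun A v => (f A v).foldl (fun s b => step b A v s) (g A v) := by
  obtain ⟨p, hp⟩ := hf.length_le
  obtain ⟨q, hq⟩ := hg.length_le
  have := fold hf hg hstep ⟨q + p * r, fun A v l' hl' => ?_⟩
  · simpa using this
  · have grow : ∀ (l : List Bool) (s : List Bool),
        (l.foldl (fun s b => step b A v s) s).length ≤ s.length + l.length * r.eval (size v) := by
      intro l
      induction l with
      | nil => simp
      | cons b l ih =>
        intro s
        have h1 := ih (step b A v s)
        have h2 := hr b A v s
        rw [List.foldl_cons, List.length_cons]
        linarith
    have h1 := grow l' (g A v)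
    have h2 := hq A v
    have h3 : l'.length ≤ p.eval (size v) := hl'.length_le.trans (hp A v)
    have h4 := Nat.mul_le_mul_right (r.eval (size v)) h3
    simp only [Fin.init_snoc, Fin.snoc_last, Polynomial.eval_add, Polynomial.eval_mul]
    omega

theorem reverse (hf : FP n f) : FP n fun A v => (f A v).reverse := by
  have := hf.foldl nil (step := fun b _ _ s => b :: s) (fun b => last.cons b) 1 (by simp)
  simpa using this

theorem append (hf : FP n f) (hg : FP n g) : FP n fun A v => f A v ++ g A v := by
  have := hf.reverse.foldl hg (step := fun b _ _ s => b :: s) (fun b => last.cons b) 1 (by simp)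
  simpa using this

/-- The length of a string in unary. Functions of numbers get their arguments as lengths of
strings. -/
theorem ones (hf : FP n f) : FP n fun A v => List.replicate (f A v).length true := by
  have := hf.foldl nil (step := fun _ _ _ s => true :: s) (fun b => last.cons true) 1 (by simp)
  have h : ∀ l : List Bool, ∀ s, l.foldl (fun s _ => true :: s) s =
      List.replicate l.length true ++ s := by
    intro l
    induction l with
    | nil => simp
    | cons b l ih => intro s; simp [ih, List.replicate_succ']
  simpa [h] using this

theorem drop (hf : FP n f) (hg : FP n g) : FP n fun A v => (g A v).drop (f A v).length := by
  have := hf.foldl hg (step := fun _ _ _ s => s.tail) (fun b => last.tail) 0 (by simp)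
  have h : ∀ l s : List Bool, l.foldl (fun s _ => s.tail) s = s.drop l.length := by
    intro l
    induction l with
    | nil => simp
    | cons b l ih => intro s; rw [List.foldl_cons, ih, List.length_cons, List.drop_tail]
  simpa [h] using this

theorem take (hf : FP n f) (hg : FP n g) : FP n fun A v => (g A v).take (f A v).length := by
  have := hf.foldl nil
    (step := fun _ A v s => match (g A v).drop s.length with
      | [] => s
      | false :: _ => false :: s
      | true :: _ => true :: s)
    (fun b => case (drop last hg.weaken) last (last.cons false) (last.cons true)) 1 (by
      intro b A v s
      rcases (g A v).drop s.length with _ | ⟨_ | _, _⟩ <;> simp)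
  have h : ∀ (w l : List Bool), l.foldl (fun s _ => match w.drop s.length with
      | [] => s
      | false :: _ => false :: s
      | true :: _ => true :: s) [] = (w.take l.length).reverse := by
    intro w l
    induction l using List.reverseRecOn with
    | nil => simp
    | append_singleton l b ih =>
      rw [List.foldl_append, ih]
      simp only [List.foldl_cons, List.foldl_nil, List.length_reverse, List.length_append,
        List.length_cons, List.length_nil]
      rcases lt_or_ge l.length w.length with hlt | hge
      · rw [List.take_add_one, List.getElem?_eq_getElem hlt,
          List.length_take_of_le hlt.le, List.drop_eq_getElem_cons hlt]
        cases w[l.length] <;> simp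
      · rw [List.take_of_length_le hge, List.drop_length, List.take_of_length_le (by omega)]
  simp only [h] at this
  simpa using this.reverse

theorem mul (hf : FP n f) (hg : FP n g) :
    FP n fun A v => List.replicate ((f A v).length * (g A v).length) true := by
  obtain ⟨q, hq⟩ := hg.length_le
  have := hf.foldl nil (step := fun _ A v s => List.replicate (g A v).length true ++ s)
    (fun b => hg.weaken.ones.append last) q (by
      intro b A v s
      have := hq A v
      simp only [List.length_append, List.length_replicate]
      omega)
  have h : ∀ (m : ℕ) (l s : List Bool),
      l.foldl (fun s _ => List.replicate m true ++ s) s =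
        List.replicate (l.length * m) true ++ s := by
    intro m l
    induction l with
    | nil => simp
    | cons b l ih =>
      intro s
      rw [List.foldl_cons, ih, ← List.append_assoc, List.replicate_append_replicate,
        List.length_cons, Nat.succ_mul]
  simpa [h] using this

theorem eval (P : Polynomial ℕ) (hf : FP n f) :
    FP n fun A v => List.replicate (P.eval (f A v).length) true := by
  induction P using Polynomial.induction_on' with
  | add P Q hP hQ =>
    have := hP.append hQ
    simpa [List.replicate_append_replicate] using this
  | monomial d a =>
    have hpow : FP n fun A v => List.replicate ((f A v).length ^ d) true := by
      induction d with
      | zero => exact const [true]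
      | succ d ih => simpa [pow_succ] using ih.mul hf
    simpa using (const (List.replicate a true)).mul hpow

theorem bit_ite {b : Lang → (Fin n → List Bool) → Bool} (hb : FP n fun A v => [b A v])
    (hf : FP n f) (hg : FP n g) : FP n fun A v => bif b A v then f A v else g A v := by
  have := case hb nil hg hf
  convert this using 3 with A v
  cases b A v <;> rfl

theorem bit_not {b : Lang → (Fin n → List Bool) → Bool} (hb : FP n fun A v => [b A v]) :
    FP n fun A v => [!b A v] := by
  convert bit_ite hb (const [false]) (const [true]) using 3 with A v
  cases b A v <;> rfl

theorem decide_eq_nil (hf : FP n f) : FP n fun A v => [decide (f A v = [])] := by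
  convert case hf (const [true]) (const [false]) (const [false]) using 3 with A v
  rcases f A v with _ | ⟨_ | _, _⟩ <;> simp

theorem decide_eq_const (hf : FP n f) (w : List Bool) : FP n fun A v => [decide (f A v = w)] := by
  induction w generalizing f with
  | nil => exact decide_eq_nil hf
  | cons b w ih =>
    cases b with
    | false =>
      convert case hf (const [false]) (ih hf.tail) (const [false]) using 3 with A v
      rcases f A v with _ | ⟨_ | _, _⟩ <;> simp
      exact decide_eq_decide.mpr Iff.rfl
    | true =>
      convert case hf (const [false]) (const [false]) (ih hf.tail) using 3 with A v
      rcases f A v with _ | ⟨_ | _, _⟩ <;> simp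
      exact decide_eq_decide.mpr Iff.rfl

theorem count (c : Bool) (hf : FP n f) :
    FP n fun A v => List.replicate ((f A v).count c) true := by
  have := hf.foldl nil (step := fun b _ _ s => bif b == c then true :: s else s)
    (fun b => by
      rcases b == c with _ | _
      · exact last
      · exact last.cons true) 1 (by
      intro b A v s
      cases b == c <;> simp)
  have h : ∀ (l s : List Bool), l.foldl (fun s b => bif b == c then true :: s else s) s =
      List.replicate (l.count c) true ++ s := by
    intro l
    induction l with
    | nil => simp
    | cons b l ih =>
      intro s
      rw [List.foldl_cons, ih, List.count_cons]
      cases h : b == c <;> simp [List.replicate_succ']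
  simpa [h] using this

/-- Compare the lengths of two strings. -/
theorem decide_length_lt (hf : FP n f) (hg : FP n g) :
    FP n fun A v => [decide ((f A v).length < (g A v).length)] := by
  convert (decide_eq_nil (hf.drop hg)).bit_not using 3 with A v
  rw [List.cons_eq_cons, Bool.eq_iff_iff]
  simp [List.drop_eq_nil_iff]

/-- The list of the values `φ 0, φ 1, …` of a predicate on numbers given in unary. -/
theorem tabulate {φ : Lang → (Fin n → List Bool) → List Bool → Bool} (hf : FP n f)
    (hφ : FP (n + 1) fun A w => [φ A (Fin.init w) (w (Fin.last n))]) :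
    FP n fun A v => (List.range (f A v).length).map fun t => φ A v (List.replicate t true) := by
  have := hf.foldl nil (step := fun _ A v s => φ A v (List.replicate s.length true) :: s)
    (fun b => by
      have h1 : FP (n + 1) fun A w =>
          [φ A (Fin.init w) (List.replicate (w (Fin.last n)).length true)] := by
        have := comp hφ (g := fun i => Fin.lastCases (motive := fun _ =>
            Lang → (Fin (n + 1) → List Bool) → List Bool)
          (fun _ w => List.replicate (w (Fin.last n)).length true) (fun i _ w => w i.castSucc) i)
          (fun i => by
            refine Fin.lastCases ?_ (fun i => ?_) i
            · simpa using last.ones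
            · simpa using proj i.castSucc)
        simpa [Fin.init_def] using this
      exact h1.append last) 1 (by simp)
  have h : ∀ (ψ : ℕ → Bool) (l : List Bool),
      l.foldl (fun s _ => ψ s.length :: s) [] = ((List.range l.length).map ψ).reverse := by
    intro ψ l
    induction l using List.reverseRecOn with
    | nil => simp
    | append_singleton l b ih =>
      rw [List.foldl_append, ih]
      simp [List.range_succ]
  have h2 := this.reverse
  convert h2 using 3 with A v
  rw [h fun t => φ A v (List.replicate t true), List.reverse_reverse]

/-- Polynomially bounded universal quantification. -/
theorem decide_forall {φ : Lang → (Fin n → List Bool) → List Bool → Bool} (hf : FP n f)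
    (hφ : FP (n + 1) fun A w => [φ A (Fin.init w) (w (Fin.last n))]) :
    FP n fun A v => [decide (∀ t < (f A v).length, φ A v (List.replicate t true) = true)] := by
  have := ((hf.tabulate hφ).count false).decide_eq_nil
  convert this using 3 with A v
  simp [List.count_eq_zero]

/-- Polynomially bounded existential quantification. -/
theorem decide_exists {φ : Lang → (Fin n → List Bool) → List Bool → Bool} (hf : FP n f)
    (hφ : FP (n + 1) fun A w => [φ A (Fin.init w) (w (Fin.last n))]) :
    FP n fun A v => [decide (∃ t < (f A v).length, φ A v (List.replicate t true) = true)] := by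
  have := (decide_forall (φ := fun A v t => !φ A v t) hf hφ.bit_not).bit_not
  convert this using 3 with A v
  rw [List.cons_eq_cons, Bool.eq_iff_iff]
  simp

theorem succString (hf : FP n f) : FP n fun A v => succString (f A v) := by
  -- the state consists of the carry bit and the reversed output
  let step : Bool → List Bool → List Bool := fun b s => match s with
    | [] => []
    | false :: w => false :: b :: w
    | true :: w => b :: (!b) :: w
  have := hf.foldl (const [true]) (step := fun b _ _ s => step b s)
    (fun b => by
      convert case (last (n := n)) nil ((last.tail.cons b).cons false) ((last.tail.cons (!b)).cons b)
        using 3 with A w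
      rcases w (Fin.last n) with _ | ⟨_ | _, _⟩ <;> rfl) 1 (by
      intro b A v s
      rcases s with _ | ⟨_ | _, _⟩ <;> simp [step])
  have h2 := case this nil this.tail.reverse (this.tail.cons false).reverse
  have h1 : ∀ l o : List Bool, l.foldl (fun s b => step b s) (false :: o) =
      false :: (l.reverse ++ o) := by
    intro l
    induction l with
    | nil => simp
    | cons b l ih => intro o; simp [step, ih]
  have key : ∀ l o : List Bool, (match l.foldl (fun s b => step b s) (true :: o) with
      | [] => []
      | false :: _ => (l.foldl (fun s b => step b s) (true :: o)).tail.reverse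
      | true :: _ => (false :: (l.foldl (fun s b => step b s) (true :: o)).tail).reverse) =
        o.reverse ++ Selectors.succString l := by
    intro l
    induction l with
    | nil => simp [Selectors.succString]
    | cons b l ih =>
      intro o
      cases b with
      | false => simp [step, h1, Selectors.succString]
      | true => simpa [step, Selectors.succString] using ih (false :: o)
  convert h2 using 3 with A v
  simpa using (key (f A v) []).symm

theorem nthString (hf : FP n f) : FP n fun A v => nthString (f A v).length := by
  have := hf.foldl nil (step := fun _ _ _ s => Selectors.succString s)
    (fun b => last.succString) 1 (by simpa using length_succString_le)
  have h : ∀ l s : List Bool, l.foldl (fun s _ => Selectors.succString s) s =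
      Selectors.succString^[l.length] s := by
    intro l
    induction l with
    | nil => simp
    | cons b l ih => intro s; simp [ih]
  simpa [h, Selectors.nthString] using this

end FP

namespace OracleMachine

/-! ### Outputs of machines and the part of the oracle they depend on -/

theorem iterate_step_congr (M : OracleMachine) {A A' : Lang} {N : ℕ}
    (h : ∀ q : List Bool, q.length ≤ N → A q = A' q) (c : Cfg M.Q) (t : ℕ)
    (hN : ∀ j, (c.stack j).length + t ≤ N) : (M.step A)^[t] c = (M.step A')^[t] c := by
  induction t with
  | zero => rfl
  | succ t ih =>
    rw [Function.iterate_succ_apply', Function.iterate_succ_apply',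
      ← ih fun j => by have := hN j; omega, step_eq, step_eq]
    set d := (M.step A)^[t] c with hd
    cases hc : M.code d.state with
    | query i qf qt =>
      have h1 := M.length_iterate_le A c t i
      have h2 := hN i
      simp only [Instr.act]
      rw [h _ (by rw [hd]; omega)]
    | push i b q => rfl
    | pop i qe qf qt => rfl
    | halt => rfl

/-- A machine that makes no queries is not influenced by the oracle. -/
theorem QueryFree.outputs_iff {M : OracleMachine} (hM : M.QueryFree) (A A' : Lang)
    (w : List (List Bool)) (y : List Bool) : M.Outputs A w y ↔ M.Outputs A' w y := by
  have : M.step A = M.step A' := by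
    funext c
    rw [step_eq, step_eq]
    cases hc : M.code c.state with
    | query i qf qt => exact absurd hc (hM _ _ _ _)
    | push i b q => rfl
    | pop i qe qf qt => rfl
    | halt => rfl
  simp only [Outputs, HaltsWithin, run, this]

theorem length_getD_le_sum (w : List (List Bool)) (j : ℕ) :
    (w.getD j []).length ≤ (w.map List.length).sum := by
  rcases lt_or_ge j w.length with h | h
  · rw [List.getD_eq_getElem _ _ h]
    exact List.single_le_sum (by simp) _ (List.mem_map_of_mem (List.getElem_mem h))
  · rw [List.getD_eq_default _ _ h]
    exact Nat.zero_le _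

/-- A polynomial-time machine depends only on short queries. -/
theorem PolyTime.exists_query_bound {M : OracleMachine} {k : ℕ} (hM : M.PolyTime k) :
    ∃ p : Polynomial ℕ, ∀ (w : List (List Bool)), w.length = k → ∀ A A' : Lang,
      (∀ q : List Bool, q.length ≤ p.eval (w.map List.length).sum → A q = A' q) →
      ∀ y, M.Outputs A w y ↔ M.Outputs A' w y := by
  obtain ⟨p, hp⟩ := hM
  refine ⟨Polynomial.X + p, fun w hw A A' h y => ?_⟩
  rw [(hp A w hw).outputs_iff, (hp A' w hw).outputs_iff, run, run, M.iterate_step_congr h]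
  intro j
  have := length_getD_le_sum w j
  simpa [init] using this

theorem Outputs.unique {M : OracleMachine} {A : Lang} {w : List (List Bool)} {y y' : List Bool}
    (h : M.Outputs A w y) (h' : M.Outputs A w y') : y = y' := by
  obtain ⟨t, ht, rfl⟩ := h
  exact (ht.outputs_iff y').mp h'

open Classical in
/-- The output of a machine (the empty string if it does not halt). -/
noncomputable def output (M : OracleMachine) (A : Lang) (w : List (List Bool)) : List Bool :=
  if h : ∃ y, M.Outputs A w y then h.choose else []

theorem PolyTime.outputs_output {M : OracleMachine} {k : ℕ} (hM : M.PolyTime k) (A : Lang)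
    {w : List (List Bool)} (hw : w.length = k) : M.Outputs A w (M.output A w) := by
  obtain ⟨p, hp⟩ := hM
  have h : ∃ y, M.Outputs A w y := ⟨_, _, hp A w hw, rfl⟩
  rw [output, dif_pos h]
  exact h.choose_spec

theorem PolyTime.outputs_iff {M : OracleMachine} {k : ℕ} (hM : M.PolyTime k) {A : Lang}
    {w : List (List Bool)} (hw : w.length = k) {y : List Bool} :
    M.Outputs A w y ↔ M.output A w = y :=
  ⟨fun h => (hM.outputs_output A hw).unique h, fun h => h ▸ hM.outputs_output A hw⟩

end OracleMachine

namespace FP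

/-- The output of a polynomial-time machine whose queries are answered by a predicate in `FP`. -/
theorem output {n k : ℕ} {M : OracleMachine} (hM : M.PolyTime k) (e : Fin k → Fin n)
    {B : Lang → (Fin n → List Bool) → List Bool → Bool}
    (hB : FP (n + 1) fun A w => [B A (Fin.init w) (w (Fin.last n))]) :
    FP n fun A v => M.output (B A v) (List.ofFn fun i => v (e i)) :=
  of_machine hM e hB fun A v => by
    simpa using hM.outputs_output (B A v) (w := List.ofFn fun i => v (e i)) (by simp)

/-- A polynomial-time machine with the given oracle. -/
theorem output_self {k : ℕ} {M : OracleMachine} (hM : M.PolyTime k) :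
    FP k fun A v => M.output A (List.ofFn v) :=
  output (B := fun A _ q => A q) hM id last.query

/-- Finite modifications of the oracle. -/
theorem patch {n : ℕ} (I : Finset (List Bool)) (B : Lang)
    {f : Lang → (Fin n → List Bool) → List Bool} (hf : FP n f) :
    FP n fun A v => [if f A v ∈ I then B (f A v) else A (f A v)] := by
  induction I using Finset.induction_on with
  | empty => simpa using hf.query
  | insert a I _ ih =>
    convert bit_ite (hf.decide_eq_const a) (const [B a]) ih using 3 with A v
    by_cases h : f A v = a
    · simp [h]
    · simp [h, Finset.mem_insert]

end FP

/-! ### There are only countably many machines -/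

instance {Q : Type} [Countable Q] : Countable (Instr Q) := by
  let f : Instr Q → (ℕ × Bool × Q) ⊕ (ℕ × Q × Q × Q) ⊕ (ℕ × Q × Q) ⊕ Unit := fun I => match I with
    | Instr.push i b q => Sum.inl (i, b, q)
    | Instr.pop i qe qf qt => Sum.inr (Sum.inl (i, qe, qf, qt))
    | Instr.query i qf qt => Sum.inr (Sum.inr (Sum.inl (i, qf, qt)))
    | Instr.halt => Sum.inr (Sum.inr (Sum.inr ()))
  refine Function.Injective.countable (f := f) fun I J h => ?_
  cases I <;> cases J <;> simp_all [f]

/-- Programs of machines whose states are numbers. -/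
abbrev Code : Type := Σ k : ℕ, Fin k × (Fin k → Instr (Fin k))

/-- The machine with a given program. -/
def Code.machine (c : Code) : OracleMachine := ⟨Fin c.1, inferInstance, c.2.1, c.2.2⟩

theorem OracleMachine.run_of_map {M M' : OracleMachine} (f : M.Q → M'.Q)
    (hstart : M'.start = f M.start) (hcode : ∀ q, M'.code (f q) = (M.code q).map f) (A : Lang)
    (w : List (List Bool)) (t : ℕ) :
    M'.run A w t = ⟨f (M.run A w t).state, (M.run A w t).stack⟩ := by
  induction t with
  | zero => exact congrArg (fun q => Cfg.mk q _) hstart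
  | succ t ih =>
    rw [show M'.run A w (t + 1) = M'.step A (M'.run A w t) from Function.iterate_succ_apply' _ _ _,
      show M.run A w (t + 1) = M.step A (M.run A w t) from Function.iterate_succ_apply' _ _ _,
      ih, step_eq, step_eq, hcode]
    exact Instr.act_map f A _ _ _

/-- Every machine is equivalent to one whose states are numbers. -/
theorem exists_code (M : OracleMachine) :
    ∃ c : Code, ∀ A w, (∀ t, M.HaltsWithin A w t → c.machine.HaltsWithin A w t) ∧
      ∀ y, M.Outputs A w y ↔ c.machine.Outputs A w y := by
  have := M.finite_states
  obtain ⟨k, ⟨e⟩⟩ := Finite.exists_equiv_fin M.Q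
  let c : Code := ⟨k, e M.start, fun q => (M.code (e.symm q)).map e⟩
  have hcode : ∀ q, c.machine.code (e q) = (M.code q).map e := by
    intro q
    simp [Code.machine, c]
  have hrun := OracleMachine.run_of_map (M' := c.machine) e rfl hcode
  have hhalt : ∀ A w t, c.machine.HaltsWithin A w t ↔ M.HaltsWithin A w t := by
    intro A w t
    unfold OracleMachine.HaltsWithin
    rw [hrun]
    exact Iff.trans (by rw [← hcode]; exact Iff.rfl)
      (Instr.map_eq_halt (f := e) (I := M.code (M.run A w t).state))
  refine ⟨c, fun A w => ⟨fun t => (hhalt A w t).mpr, fun y => ?_⟩⟩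
  simp only [OracleMachine.Outputs, hhalt, hrun]

theorem countable_natPolynomial : Countable (Polynomial ℕ) := by
  rw [← Cardinal.mk_le_aleph0_iff]
  exact Polynomial.cardinalMk_le_max.trans (by simp)

/-! ### From advice to selectors -/

/-- The oracles through which, for each length, `L` is accessible at one of the prefixes `0`, `1`. -/
def HalvesContain (L B : Lang) : Prop :=
  ∀ n, (∀ x : List Bool, x.length = n → B (false :: x) = L x) ∨
    ∀ x : List Bool, x.length = n → B (true :: x) = L x

/-- The advice bit is the prefix behind which `L` is found. -/
theorem inPOneAdvice_of_halvesContain {L R : Lang} (h : HalvesContain L R) : InPOneAdvice R L := by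
  have hF : FP 2 fun A v => [A (v 1 ++ v 0)] := ((FP.proj 1).append (FP.proj 0)).query
  obtain ⟨M, hM, hout⟩ := hF.exists_machine (by omega)
  have hα : ∀ n, ∃ a : Bool, ∀ x : List Bool, x.length = n → R (a :: x) = L x := fun n =>
    (h n).elim (fun h => ⟨false, h⟩) fun h => ⟨true, h⟩
  choose α hα using hα
  refine ⟨M, α, hM, fun x => ?_⟩
  have := hout R ![x, [α x.length]]
  simpa [hα x.length x rfl] using this

theorem isClosed_halvesContain (L : Lang) : IsClosed {B | HalvesContain L B} := by
  simp only [HalvesContain, Set.ofPred_forall, Set.ofPred_or]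
  exact isClosed_iInter fun n => IsClosed.union
    (isClosed_iInter fun x => isClosed_iInter fun _ =>
      isClosed_eq (continuous_apply _) continuous_const)
    (isClosed_iInter fun x => isClosed_iInter fun _ =>
      isClosed_eq (continuous_apply _) continuous_const)

/-- The success probability on a fixed input depends on a finite part of the oracle only. -/
theorem isLocallyConstant_answerProb {M : OracleMachine} (hM : M.PolyTime 2) (ρ : Polynomial ℕ)
    (x : List Bool) (b : Bool) : IsLocallyConstant fun A : Lang => answerProb M ρ A x b := by
  obtain ⟨p, hp⟩ := hM.exists_query_bound
  rw [IsLocallyConstant.iff_exists_open]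
  intro A
  set N := p.eval (x.length + ρ.eval x.length) with hN
  refine ⟨⋂ q ∈ {q : List Bool | q.length ≤ N}, (fun A' : Lang => A' q) ⁻¹' {A q}, ?_, ?_, ?_⟩
  · exact (List.finite_length_le Bool N).isOpen_biInter fun q _ =>
      (isOpen_discrete {A q}).preimage (continuous_apply q)
  · simp
  · intro A' hA'
    simp only [Set.mem_iInter, Set.mem_ofPred_eq, Set.mem_preimage, Set.mem_singleton_iff] at hA'
    have : ∀ r : Fin (ρ.eval x.length) → Bool, M.Outputs A' [x, List.ofFn r] [b] ↔
        M.Outputs A [x, List.ofFn r] [b] := fun r =>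
      hp [x, List.ofFn r] rfl A' A (fun q hq => hA' q (by simpa [hN] using hq)) [b]
    simp only [answerProb, coinProb, this]

theorem hasSelector_of_forall_oracle {L : Lang} (h : ∀ R, InPOneAdvice R L → InBPP R L) :
    HasSelector L := by
  have := countable_natPolynomial
  let X := {B : Lang // HalvesContain L B}
  have : CompactSpace X := isCompact_iff_compactSpace.mp (isClosed_halvesContain L).isCompact
  have : Nonempty X := ⟨⟨join L L, fun n => Or.inl fun x _ => rfl⟩⟩
  let ι := {c : Code × Polynomial ℕ // c.1.machine.PolyTime 2}
  let F : ι → Set X := fun c =>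
    {B | ∀ x, 2 / 3 ≤ answerProb c.1.1.machine c.1.2 B.1 x (L x)}
  have hF : ∀ c, IsClosed (F c) := by
    intro c
    simp only [F, Set.ofPred_forall]
    exact isClosed_iInter fun x => isClosed_le continuous_const
      ((isLocallyConstant_answerProb c.2 c.1.2 x (L x)).continuous.comp continuous_subtype_val)
  have hU : ⋃ c, F c = Set.univ := by
    rw [Set.eq_univ_iff_forall]
    rintro ⟨R, hR⟩
    obtain ⟨M, ρ, ⟨p, hp⟩, hprob⟩ := h R (inPOneAdvice_of_halvesContain hR)
    obtain ⟨c, hc⟩ := exists_code M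
    refine Set.mem_iUnion.mpr ⟨⟨(c, ρ), p, fun A w hw => (hc A w).1 _ (hp A w hw)⟩, fun x => ?_⟩
    have := hprob x
    simpa only [answerProb, (hc _ _).2] using this
  obtain ⟨⟨⟨c, ρ⟩, hc⟩, ⟨B, hB⟩, hint⟩ := nonempty_interior_of_iUnion_of_closed hF hU
  -- a neighbourhood of `B` consists of all oracles that agree with `B` on short strings
  obtain ⟨N, hN⟩ : ∃ N, ∀ B' : Lang, HalvesContain L B' →
      (∀ q : List Bool, q.length ≤ N → B' q = B q) →
      ∀ x, 2 / 3 ≤ answerProb c.machine ρ B' x (L x) := by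
    obtain ⟨U, hU1, hU2⟩ := isOpen_induced_iff.mp (isOpen_interior (s := F ⟨(c, ρ), hc⟩))
    have hBU : B ∈ U := by
      have : (⟨B, hB⟩ : X) ∈ Subtype.val ⁻¹' U := by rw [hU2]; exact hint
      exact this
    obtain ⟨I, u, hu, hIu⟩ := isOpen_pi_iff.mp hU1 B hBU
    refine ⟨I.sup List.length, fun B' hB' hagree => ?_⟩
    have hB'U : B' ∈ U := hIu fun q hq => by
      rw [hagree q (Finset.le_sup (f := List.length) hq)]
      exact (hu q hq).2
    have : (⟨B', hB'⟩ : X) ∈ interior (F ⟨(c, ρ), hc⟩) := by rw [← hU2]; exact hB'U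
    exact interior_subset this
  let I : Finset (List Bool) := (List.finite_length_le Bool N).toFinset
  let patched : Lang → Lang := fun A q => if q ∈ I then B q else A q
  have hI : ∀ q, q ∈ I ↔ q.length ≤ N := fun q => by simp [I]
  have hS : FP 2 fun A v => c.machine.output (patched A) (List.ofFn v) :=
    FP.output (B := fun A _ => patched A) hc id (FP.last.patch I B)
  obtain ⟨S, hS1, hS2⟩ := hS.exists_machine (by omega)
  refine ⟨S, ρ, hS1, fun x A₀ A₁ hA => ?_⟩
  have hvalid : HalvesContain L (patched (join A₀ A₁)) := by
    intro n
    by_cases hn : n + 1 ≤ N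
    · refine (hB n).imp (fun h x hx => ?_) fun h x hx => ?_
      all_goals rw [← h x hx]; exact if_pos ((hI _).mpr (by simpa [hx] using hn))
    · refine hA.imp (fun h x hx => ?_) fun h x hx => ?_
      all_goals rw [← h]; exact if_neg (by rw [hI]; simpa [hx] using hn)
  have := hN _ hvalid (fun q hq => if_pos ((hI q).mpr hq)) x
  have hout : ∀ r y, S.Outputs (join A₀ A₁) [x, r] y ↔
      c.machine.Outputs (patched (join A₀ A₁)) [x, r] y := by
    intro r y
    rw [hc.outputs_iff (w := [x, r]) rfl]
    have hr := hS2 (join A₀ A₁) ![x, r]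
    simp only [List.ofFn_succ, List.ofFn_zero, Matrix.cons_val_zero, Matrix.cons_val_succ] at hr
    exact ⟨fun h => hr.unique h, fun h => h ▸ hr⟩
  simpa only [answerProb, hout] using this

/-! ### Averages over coin flips -/

/-- The average of `f` over all strings of length `m`. -/
noncomputable def avg (m : ℕ) (f : List Bool → ℝ) : ℝ :=
  (∑ r : Fin m → Bool, f (List.ofFn r)) / 2 ^ m

theorem avg_congr {m : ℕ} {f g : List Bool → ℝ} (h : ∀ r : List Bool, r.length = m → f r = g r) :
    avg m f = avg m g := by
  unfold avg
  rw [Finset.sum_congr rfl fun r _ => h (List.ofFn r) (by simp)]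

theorem avg_mono {m : ℕ} {f g : List Bool → ℝ} (h : ∀ r : List Bool, r.length = m → f r ≤ g r) :
    avg m f ≤ avg m g := by
  unfold avg
  gcongr with r
  exact h _ (by simp)

theorem avg_const (m : ℕ) (c : ℝ) : avg m (fun _ => c) = c := by
  simp [avg]

theorem avg_add (m : ℕ) (f g : List Bool → ℝ) :
    avg m (fun r => f r + g r) = avg m f + avg m g := by
  simp [avg, Finset.sum_add_distrib, add_div]

theorem avg_const_mul (m : ℕ) (c : ℝ) (f : List Bool → ℝ) :
    avg m (fun r => c * f r) = c * avg m f := by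
  simp [avg, ← Finset.mul_sum, mul_div_assoc]

theorem avg_sum {ι : Type*} (s : Finset ι) (m : ℕ) (f : ι → List Bool → ℝ) :
    avg m (fun r => ∑ i ∈ s, f i r) = ∑ i ∈ s, avg m (f i) := by
  simp only [avg, ← Finset.sum_div]
  rw [Finset.sum_comm]

/-- Independence of consecutive blocks of coin flips. -/
theorem avg_append (a b : ℕ) (f : List Bool → ℝ) :
    avg (a + b) f = avg a fun r => avg b fun s => f (r ++ s) := by
  unfold avg
  rw [← Finset.sum_div, div_div, ← pow_add, add_comm b a, ← (Fin.appendEquiv a b).sum_comp,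
    Fintype.sum_prod_type]
  simp [Fin.appendEquiv, List.ofFn_fin_append]

theorem coinProb_eq_avg (m : ℕ) (E : List Bool → Prop) [DecidablePred E] :
    coinProb m E = avg m fun r => if E r then 1 else 0 := by
  unfold coinProb avg
  rw [Nat.card_eq_fintype_card, Fintype.card_subtype, Finset.sum_boole]

theorem coinProb_mono {m : ℕ} {E F : List Bool → Prop}
    (h : ∀ r : List Bool, r.length = m → E r → F r) : coinProb m E ≤ coinProb m F := by
  classical
  rw [coinProb_eq_avg, coinProb_eq_avg]
  refine avg_mono fun r hr => ?_
  by_cases hE : E r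
  · simp [hE, h r hr hE]
  · rw [if_neg hE]; split_ifs <;> norm_num

/-- The union bound. -/
theorem one_sub_sum_le_coinProb {ι : Type*} (s : Finset ι) (m : ℕ) (E : ι → List Bool → Prop) :
    1 - ∑ i ∈ s, coinProb m (fun r => ¬E i r) ≤ coinProb m fun r => ∀ i ∈ s, E i r := by
  classical
  rw [sub_le_iff_le_add]
  simp only [coinProb_eq_avg, ← avg_sum, ← avg_add]
  refine (avg_const m 1).symm.trans_le (avg_mono fun r _ => ?_)
  have h0 : ∀ i ∈ s, (0 : ℝ) ≤ if ¬E i r then 1 else 0 := fun i _ => by split_ifs <;> norm_num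
  by_cases h : ∀ i ∈ s, E i r
  · rw [if_pos h]
    linarith [Finset.sum_nonneg h0]
  · rw [if_neg h]
    push Not at h
    obtain ⟨i, hi, hE⟩ := h
    have := Finset.single_le_sum h0 hi
    rw [if_pos hE] at this
    linarith

theorem mul_le_coinProb_append {a b : ℕ} {p q : ℝ} (hq : 0 ≤ q) {G E : List Bool → Prop}
    (hG : p ≤ coinProb a G)
    (hE : ∀ r : List Bool, r.length = a → G r → q ≤ coinProb b fun s => E (r ++ s)) :
    p * q ≤ coinProb (a + b) E := by
  classical
  calc p * q ≤ coinProb a G * q := by gcongr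
    _ = avg a fun r => q * if G r then 1 else 0 := by
      rw [avg_const_mul, coinProb_eq_avg, mul_comm]
    _ ≤ coinProb (a + b) E := by
      rw [coinProb_eq_avg, avg_append]
      refine avg_mono fun r hr => ?_
      by_cases h : G r
      · rw [if_pos h, mul_one]
        exact (hE r hr h).trans (coinProb_eq_avg _ _).le
      · rw [if_neg h, mul_zero]
        exact (avg_const b 0).symm.trans_le (avg_mono fun s _ => by split_ifs <;> norm_num)

/-- The sum of the values of `h` on the first `T` blocks of length `b`. -/
def sumBlocks (b : ℕ) (h : List Bool → ℝ) : ℕ → List Bool → ℝ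
  | 0, _ => 0
  | T + 1, s => h (s.take b) + sumBlocks b h T (s.drop b)

/-- A sum of independent centred variables is centred, and its variance is at most the sum of the
variances. -/
theorem avg_sumBlocks {b : ℕ} {h : List Bool → ℝ} (h0 : avg b h = 0)
    (h1 : avg b (fun s => h s ^ 2) ≤ 1) (T : ℕ) :
    avg (T * b) (sumBlocks b h T) = 0 ∧ avg (T * b) (fun s => sumBlocks b h T s ^ 2) ≤ T := by
  induction T with
  | zero => simp [sumBlocks, avg_const]
  | succ T ih =>
    have hT : (T + 1) * b = b + T * b := by ring
    have hs : ∀ r s : List Bool, r.length = b →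
        sumBlocks b h (T + 1) (r ++ s) = h r + sumBlocks b h T s := by
      intro r s hr
      simp [sumBlocks, ← hr]
    rw [hT, avg_append, avg_append]
    constructor
    · rw [avg_congr (g := h) fun r hr => ?_, h0]
      rw [avg_congr (g := fun s => h r + sumBlocks b h T s) fun s _ => hs r s hr, avg_add,
        avg_const, ih.1, add_zero]
    · rw [avg_congr (g := fun r => h r ^ 2 + avg (T * b) fun s => sumBlocks b h T s ^ 2)
        fun r hr => ?_, avg_add, avg_const]
      · push_cast
        linarith [ih.2]
      · rw [avg_congr (g := fun s => (h r ^ 2 + (2 * h r) * sumBlocks b h T s) +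
          sumBlocks b h T s ^ 2) fun s _ => by rw [hs r s hr]; ring, avg_add, avg_add, avg_const,
          avg_const_mul, ih.1]
        ring

/-- The votes cast with the first `T` blocks of `b` coin flips. -/
def votes (b T : ℕ) (φ : List Bool → Bool) (s : List Bool) : List Bool :=
  (List.range T).map fun t => φ ((s.drop (t * b)).take b)

theorem sumBlocks_eq_count (b T : ℕ) (φ : List Bool → Bool) (c : Bool) (p : ℝ) (s : List Bool) :
    sumBlocks b (fun s => (if φ s = c then 1 else 0) - p) T s =
      (votes b T φ s).count c - T * p := by
  induction T generalizing s with
  | zero => simp [sumBlocks, votes]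
  | succ T ih =>
    have h : votes b (T + 1) φ s = φ (s.take b) :: votes b T φ (s.drop b) := by
      simp only [votes, List.range_succ_eq_map, List.map_cons, List.map_map]
      congr 1
      · simp
      · refine List.map_congr_left fun t _ => ?_
        simp only [Function.comp, List.drop_drop]
        congr 3
        rw [Nat.succ_mul, add_comm]
    rw [sumBlocks, ih, h, List.count_cons]
    by_cases hc : φ (s.take b) = c <;> simp [hc] <;> ring

/-- Amplification by a majority vote: Chebyshev's inequality. -/
theorem coinProb_majority_le {b T : ℕ} (hT : 0 < T) {φ : List Bool → Bool} {c : Bool}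
    (h : 2 / 3 ≤ coinProb b fun s => φ s = c) :
    coinProb (T * b) (fun s => ¬(votes b T φ s).count (!c) < (votes b T φ s).count c) ≤
      36 / T := by
  classical
  set p := coinProb b fun s => φ s = c with hp
  have hp1 : p ≤ 1 := by
    rw [hp, coinProb_eq_avg]
    exact (avg_mono fun s _ => by split_ifs <;> norm_num).trans_eq (avg_const b 1)
  have hT' : (0 : ℝ) < T := by exact_mod_cast hT
  obtain ⟨-, hvar⟩ := avg_sumBlocks (b := b) (h := fun s => (if φ s = c then 1 else 0) - p)
    (by
      have := avg_add b (fun s => if φ s = c then 1 else 0) fun _ => -p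
      rw [avg_const, ← coinProb_eq_avg b fun s => φ s = c, ← hp] at this
      simpa [sub_eq_add_neg] using this)
    (by
      refine (avg_mono fun s _ => ?_).trans_eq (avg_const b 1)
      split_ifs <;> nlinarith) T
  rw [coinProb_eq_avg]
  calc _ ≤ avg (T * b) fun s => 36 / (T : ℝ) ^ 2 *
        sumBlocks b (fun s => (if φ s = c then 1 else 0) - p) T s ^ 2 := by
        refine avg_mono fun s _ => ?_
        by_cases hs : (votes b T φ s).count (!c) < (votes b T φ s).count c
        · rw [if_neg (not_not.mpr hs)]
          positivity
        · rw [if_pos hs, sumBlocks_eq_count]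
          have h1 := List.count_not_add_count (votes b T φ s) c
          have h2 : (votes b T φ s).length = T := by simp [votes]
          have h3 : 2 * ((votes b T φ s).count c : ℝ) ≤ T := by
            have : 2 * (votes b T φ s).count c ≤ T := by omega
            exact_mod_cast this
          set k : ℝ := (((votes b T φ s).count c : ℕ) : ℝ)
          have h4 : (T : ℝ) / 6 ≤ T * p - k := by nlinarith
          have h5 : (T : ℝ) ^ 2 / 36 ≤ (k - T * p) ^ 2 := by nlinarith
          rw [div_mul_eq_mul_div, le_div_iff₀ (by positivity)]
          linarith
    _ ≤ 36 / (T : ℝ) ^ 2 * T := by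
        rw [avg_const_mul]
        gcongr
    _ = 36 / T := by field_simp

/-! ### Selecting a good advice string -/

/-- The candidate for `L` that the machine `M` with coin flips `r` and advice `w` provides, where
`D` pads every query to length `m`. -/
noncomputable def adviceOracle (M D : OracleMachine) (R : Lang) (m : ℕ) (r w : List Bool) : Lang :=
  fun q => decide (M.output R [D.output R [q, List.replicate m true], r, w] = [true])

/-- One run of the selector `S`, with coin flips `s`, on the candidates given by `w` and `w'`. -/
noncomputable def trial (S M D : OracleMachine) (R : Lang) (m : ℕ) (x r w w' s : List Bool) :
    Bool :=
  decide (S.output (join (adviceOracle M D R m r w) (adviceOracle M D R m r w')) [x, s] = [true])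

/-- The majority of `T` runs of the selector on the candidates with numbers `k` and `j`; `a` coin
flips are used for the candidates, and `b` coin flips for each of the runs. -/
noncomputable def duel (S M D : OracleMachine) (R : Lang) (m a b T : ℕ) (x z : List Bool)
    (k j : ℕ) : Bool :=
  let l := votes b T (trial S M D R m x (z.take a) (nthString k) (nthString j)) (z.drop a)
  decide (l.count false < l.count true)

/-- Accept if one of the first `K` candidates wins with the answer "yes" against all others. -/
noncomputable def tournament (S M D : OracleMachine) (R : Lang) (m a b T K : ℕ) (x z : List Bool) :
    Bool :=
  decide (∃ k < K, ∀ j < K, duel S M D R m a b T x z k j = true)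

namespace FP

variable {S M D : OracleMachine}

theorem adviceOracle (hM : M.PolyTime 3) (hD : D.PolyTime 2) {n : ℕ}
    {u r w q : Lang → (Fin n → List Bool) → List Bool}
    (hu : FP n u) (hr : FP n r) (hw : FP n w) (hq : FP n q) :
    FP n fun A v => [adviceOracle M D A (u A v).length (r A v) (w A v) (q A v)] := by
  have hp := comp₂ (output_self hD) hq hu.ones
  have := (comp₃ (output_self hM) hp hr hw).decide_eq_const [true]
  simpa [Selectors.adviceOracle] using this

theorem trial (hS : S.PolyTime 2) (hM : M.PolyTime 3) (hD : D.PolyTime 2) {n : ℕ}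
    {u x r w w' s : Lang → (Fin n → List Bool) → List Bool} (hu : FP n u) (hx : FP n x)
    (hr : FP n r) (hw : FP n w) (hw' : FP n w') (hs : FP n s) :
    FP n fun A v => [trial S M D A (u A v).length (x A v) (r A v) (w A v) (w' A v) (s A v)] := by
  have hj : FP 7 fun A v => [join
      (Selectors.adviceOracle M D A (v 2).length (v 3) (v 4))
      (Selectors.adviceOracle M D A (v 2).length (v 3) (v 5)) (v 6)] := by
    have h4 := adviceOracle hM hD (proj 2) (proj 3) (proj 4) (proj (n := 7) 6).tail
    have h5 := adviceOracle hM hD (proj 2) (proj 3) (proj 5) (proj (n := 7) 6).tail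
    convert case (proj 6) (const [false]) h4 h5 using 3 with A v
    rcases v 6 with _ | ⟨_ | _, _⟩ <;> rfl
  have h6 := (output (n := 6) hS ![0, 1] (B := fun A v => join
      (Selectors.adviceOracle M D A (v 2).length (v 3) (v 4))
      (Selectors.adviceOracle M D A (v 2).length (v 3) (v 5))) hj).decide_eq_const [true]
  have := comp h6 (g := ![x, s, u, r, w, w'])
    (by simp [Fin.forall_fin_succ, hu, hx, hr, hw, hw', hs])
  simpa [Selectors.trial] using this

theorem duel (hS : S.PolyTime 2) (hM : M.PolyTime 3) (hD : D.PolyTime 2) {n : ℕ}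
    {u a b t x z k j : Lang → (Fin n → List Bool) → List Bool} (hu : FP n u) (ha : FP n a)
    (hb : FP n b) (ht : FP n t) (hx : FP n x) (hz : FP n z) (hk : FP n k) (hj : FP n j) :
    FP n fun A v => [duel S M D A (u A v).length (a A v).length (b A v).length (t A v).length
      (x A v) (z A v) (k A v).length (j A v).length] := by
  have h1 : FP n fun A v => votes (b A v).length (t A v).length
      (Selectors.trial S M D A (u A v).length (x A v) ((z A v).take (a A v).length)
        (Selectors.nthString (k A v).length) (Selectors.nthString (j A v).length))
      ((z A v).drop (a A v).length) := by
    have := ht.tabulate (φ := fun A v i => Selectors.trial S M D A (u A v).length (x A v)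
        ((z A v).take (a A v).length) (Selectors.nthString (k A v).length)
        (Selectors.nthString (j A v).length)
        ((((z A v).drop (a A v).length).drop (i.length * (b A v).length)).take (b A v).length)) (by
      have hd := (last (n := n)).mul hb.weaken |>.drop (ha.drop hz).weaken
      have := trial hS hM hD hu.weaken hx.weaken (ha.take hz).weaken hk.nthString.weaken
        hj.nthString.weaken (hb.weaken.take hd)
      simpa using this)
    simpa [votes] using this
  have := (h1.count false).decide_length_lt (h1.count true)
  simpa [Selectors.duel] using this

theorem tournament (hS : S.PolyTime 2) (hM : M.PolyTime 3) (hD : D.PolyTime 2) {n : ℕ}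
    {u a b t c x z : Lang → (Fin n → List Bool) → List Bool} (hu : FP n u) (ha : FP n a)
    (hb : FP n b) (ht : FP n t) (hc : FP n c) (hx : FP n x) (hz : FP n z) :
    FP n fun A v => [tournament S M D A (u A v).length (a A v).length (b A v).length
      (t A v).length (c A v).length (x A v) (z A v)] := by
  have := hc.decide_exists (φ := fun A v k => decide (∀ j < (c A v).length,
      Selectors.duel S M D A (u A v).length (a A v).length (b A v).length (t A v).length (x A v)
        (z A v) k.length j = true)) (by
    have := hc.weaken.decide_forall (φ := fun A w j => Selectors.duel S M D A
        (u A (Fin.init w)).length (a A (Fin.init w)).length (b A (Fin.init w)).length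
        (t A (Fin.init w)).length (x A (Fin.init w)) (z A (Fin.init w))
        (w (Fin.last n)).length j.length)
      (duel hS hM hD hu.weaken.weaken ha.weaken.weaken hb.weaken.weaken ht.weaken.weaken
        hx.weaken.weaken hz.weaken.weaken last.weaken last)
    simpa using this)
  simpa [Selectors.tournament] using this

end FP

variable {S M D : OracleMachine} {L R : Lang}

/-- With the right advice for the length `m`, the candidate agrees with `L` on all strings of length
at most `m`. -/
theorem adviceOracle_eq (hM : M.PolyTime 3) (hD : D.PolyTime 2) (hDfree : D.QueryFree)
    (hpad : ∀ (x : List Bool) (m : ℕ), x.length ≤ m →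
      ∃ y : List Bool, D.Outputs (fun _ => false) [x, List.replicate m true] y ∧
        y.length = m ∧ L y = L x)
    {m : ℕ} {r w : List Bool} (hw : ∀ y : List Bool, y.length = m → M.Outputs R [y, r, w] [L y])
    {q : List Bool} (hq : q.length ≤ m) : adviceOracle M D R m r w q = L q := by
  obtain ⟨y, hy1, hy2, hy3⟩ := hpad q m hq
  rw [hDfree.outputs_iff _ R, hD.outputs_iff rfl] at hy1
  have := hw y hy2
  rw [hM.outputs_iff rfl] at this
  simp [adviceOracle, hy1, this, hy3]

/-- A trial is correct with probability `2 / 3` as soon as one of the two candidates agrees with `L` on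
all strings of length at most `m`, provided that the selector makes no longer queries. -/
theorem le_coinProb_trial (hS : S.PolyTime 2) {ρ : Polynomial ℕ}
    (hsel : ∀ (x : List Bool) (A₀ A₁ : Lang), (A₀ = L ∨ A₁ = L) →
      2 / 3 ≤ answerProb S ρ (join A₀ A₁) x (L x)) {N : ℕ} {x : List Bool}
    (hN : ∀ s : List Bool, s.length = ρ.eval x.length → ∀ A A' : Lang,
      (∀ q : List Bool, q.length ≤ N → A q = A' q) →
      ∀ y, S.Outputs A [x, s] y ↔ S.Outputs A' [x, s] y)
    {m : ℕ} (hm : N ≤ m) {r w w' : List Bool}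
    (hw : (∀ q : List Bool, q.length ≤ m → adviceOracle M D R m r w q = L q) ∨
      ∀ q : List Bool, q.length ≤ m → adviceOracle M D R m r w' q = L q) :
    2 / 3 ≤ coinProb (ρ.eval x.length) fun s => trial S M D R m x r w w' s = L x := by
  -- replacing the good candidate by `L` itself is not noticed by the selector
  obtain ⟨A₀, A₁, hA, hagree⟩ : ∃ A₀ A₁ : Lang, (A₀ = L ∨ A₁ = L) ∧ ∀ q : List Bool,
      q.length ≤ N → join A₀ A₁ q =
        join (adviceOracle M D R m r w) (adviceOracle M D R m r w') q := by
    rcases hw with hw | hw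
    · refine ⟨L, adviceOracle M D R m r w', Or.inl rfl, fun q hq => ?_⟩
      rcases q with _ | ⟨_ | _, q⟩
      · rfl
      · exact (hw q (by simp only [List.length_cons] at hq; omega)).symm
      · rfl
    · refine ⟨adviceOracle M D R m r w, L, Or.inr rfl, fun q hq => ?_⟩
      rcases q with _ | ⟨_ | _, q⟩
      · rfl
      · rfl
      · exact (hw q (by simp only [List.length_cons] at hq; omega)).symm
  refine (hsel x A₀ A₁ hA).trans (coinProb_mono fun s hs h => ?_)
  rw [hN s hs _ _ hagree, hS.outputs_iff rfl] at h
  simp [trial, h]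

/-- If one candidate wins all its duels, on either side, with the answer `c`, then the tournament
gives the answer `c`, whatever happens in the other duels. -/
theorem tournament_eq {m a b T K : ℕ} {x z : List Bool} {k : ℕ} {c : Bool} (hk : k < K)
    (h : ∀ j < K, duel S M D R m a b T x z k j = c ∧ duel S M D R m a b T x z j k = c) :
    tournament S M D R m a b T K x z = c := by
  unfold tournament
  cases c with
  | true => exact decide_eq_true ⟨k, hk, fun j hj => (h j hj).1⟩
  | false =>
    refine decide_eq_false ?_
    rintro ⟨j, hj, hj'⟩
    have h1 := hj' k hk
    rw [(h j hj).2] at h1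
    cases h1

theorem coinProb_duel_ne_le {m b T : ℕ} (hT : 0 < T) {x r : List Bool} {k j : ℕ} {c : Bool}
    (h : 2 / 3 ≤ coinProb b fun s => trial S M D R m x r (nthString k) (nthString j) s = c) :
    coinProb (T * b) (fun s => ¬duel S M D R m r.length b T x (r ++ s) k j = c) ≤ 36 / T := by
  refine (coinProb_mono fun s _ hs => ?_).trans (coinProb_majority_le hT h)
  intro hlt
  apply hs
  simp only [duel, List.take_left, List.drop_left]
  cases c with
  | true => exact decide_eq_true hlt
  | false => exact decide_eq_false hlt.not_gt

/-- There are only polynomially many advice strings of logarithmic length. -/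
theorem exists_lt_nthString_eq {c m : ℕ} (hm : 0 < m) {w : List Bool}
    (hw : w.length ≤ c * Nat.log 2 m + c) : ∃ k < 2 ^ (c + 1) * m ^ c, nthString k = w := by
  obtain ⟨k, hk, rfl⟩ := exists_nthString_eq w
  refine ⟨k, ?_, rfl⟩
  calc k < 2 ^ ((nthString k).length + 1) := by omega
    _ ≤ 2 ^ (c * Nat.log 2 m + c + 1) := Nat.pow_le_pow_right (by norm_num) (by omega)
    _ = 2 ^ (c + 1) * (2 ^ Nat.log 2 m) ^ c := by rw [← pow_mul, ← pow_add]; ring_nf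
    _ ≤ 2 ^ (c + 1) * m ^ c := by gcongr; exact Nat.pow_log_le_self 2 hm.ne'

theorem inBPP_of_hasSelector (hpad : Paddable L) (hsel : HasSelector L)
    (hadv : InBPPLogAdvice R L) : InBPP R L := by
  obtain ⟨D, hDfree, hD, hpad⟩ := hpad
  obtain ⟨S, ρ, hS, hsel⟩ := hsel
  obtain ⟨M, ρ', α, c, hM, hα, hgood⟩ := hadv
  obtain ⟨Q, hQ⟩ := hS.exists_query_bound
  -- all queries of the selector are padded to the length `m`
  let P : Polynomial ℕ := Q.comp (Polynomial.X + ρ) + 1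
  let PK : Polynomial ℕ := Polynomial.C (2 ^ (c + 1)) * P ^ c
  -- enough runs to push the error of `2 * K` duels below `1 / 5`
  let PT : Polynomial ℕ := 360 * PK
  have hF : FP 2 fun A v => [tournament S M D A (P.eval (v 0).length)
      ((ρ'.comp P).eval (v 0).length) (ρ.eval (v 0).length) (PT.eval (v 0).length)
      (PK.eval (v 0).length) (v 0) (v 1)] := by
    have hx : FP 2 fun _ v => v 0 := FP.proj 0
    simpa using FP.tournament hS hM hD (hx.eval P) (hx.eval (ρ'.comp P)) (hx.eval ρ) (hx.eval PT)
      (hx.eval PK) hx (FP.proj 1)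
  obtain ⟨B, hB, hout⟩ := hF.exists_machine (by omega)
  refine ⟨B, ρ'.comp P + PT * ρ, hB, fun x => ?_⟩
  set m := P.eval x.length with hm
  set a := ρ'.eval m with ha
  set b := ρ.eval x.length with hb
  set K := PK.eval x.length with hK
  have hKm : K = 2 ^ (c + 1) * m ^ c := by simp [hK, PK, hm]
  have hm0 : 0 < m := by simp [hm, P]
  have hK0 : 0 < K := by rw [hKm]; positivity
  have hTK : PT.eval x.length = 360 * K := by simp [PT, hK]
  have hlen : (ρ'.comp P + PT * ρ).eval x.length = a + 360 * K * b := by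
    simp [Polynomial.eval_comp, hTK, ha, hb, hm]
  have hN : ∀ s : List Bool, s.length = b → ∀ A A' : Lang,
      (∀ q : List Bool, q.length ≤ Q.eval (x.length + b) → A q = A' q) →
      ∀ y, S.Outputs A [x, s] y ↔ S.Outputs A' [x, s] y := by
    intro s hs A A' h
    exact hQ [x, s] rfl A A' (by simpa [hs] using h)
  have hNm : Q.eval (x.length + b) ≤ m := by simp [hm, P, hb]
  rw [answerProb, hlen]
  have main : (5 / 6 : ℝ) * (4 / 5) ≤ coinProb (a + 360 * K * b) fun z =>
      tournament S M D R m a b (360 * K) K x z = L x := by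
    refine mul_le_coinProb_append (by norm_num) (hgood m) fun r hr hrgood => ?_
    obtain ⟨k, hk, hkα⟩ := exists_lt_nthString_eq hm0 (hα m r hr)
    rw [← hKm] at hk
    have hcand : ∀ q : List Bool, q.length ≤ m →
        adviceOracle M D R m r (nthString k) q = L q := fun q hq =>
      adviceOracle_eq hM hD hDfree hpad (fun y hy => hkα ▸ hrgood y hy) hq
    have hT0 : 0 < 360 * K := by omega
    have h1 : ∀ j, coinProb (360 * K * b) (fun s =>
        ¬duel S M D R m a b (360 * K) x (r ++ s) k j = L x) ≤ 36 / (360 * K : ℕ) := fun j => by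
      rw [← hr]
      exact coinProb_duel_ne_le hT0 (le_coinProb_trial hS hsel hN hNm (Or.inl hcand))
    have h2 : ∀ j, coinProb (360 * K * b) (fun s =>
        ¬duel S M D R m a b (360 * K) x (r ++ s) j k = L x) ≤ 36 / (360 * K : ℕ) := fun j => by
      rw [← hr]
      exact coinProb_duel_ne_le hT0 (le_coinProb_trial hS hsel hN hNm (Or.inr hcand))
    have hunion := one_sub_sum_le_coinProb (Finset.range K ×ˢ (Finset.univ : Finset Bool))
      (360 * K * b) fun i s => (bif i.2 then duel S M D R m a b (360 * K) x (r ++ s) k i.1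
        else duel S M D R m a b (360 * K) x (r ++ s) i.1 k) = L x
    have hsum : ∑ i ∈ Finset.range K ×ˢ (Finset.univ : Finset Bool), coinProb (360 * K * b)
        (fun s => ¬(bif i.2 then duel S M D R m a b (360 * K) x (r ++ s) k i.1
          else duel S M D R m a b (360 * K) x (r ++ s) i.1 k) = L x) ≤ 1 / 5 := by
      refine (Finset.sum_le_card_nsmul _ _ (36 / (360 * K : ℕ) : ℝ) fun i _ => ?_).trans_eq ?_
      · obtain ⟨j, _ | _⟩ := i
        · exact h2 j
        · exact h1 j
      · have : (K : ℝ) ≠ 0 := by exact_mod_cast hK0.ne'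
        simp
        field_simp
        norm_num
    refine le_trans (by linarith [hsum]) (hunion.trans (coinProb_mono fun s _ hs => ?_))
    exact tournament_eq hk fun j hj =>
      ⟨hs (j, true) (by simpa using hj), hs (j, false) (by simpa using hj)⟩
  refine le_trans (by norm_num) (main.trans (coinProb_mono fun z _ hz => ?_))
  have := hout R ![x, z]
  simp [Polynomial.eval_comp, hTK, ← hm, ← ha, ← hb, ← hK] at this
  rwa [hz] at this

end Selectors

theorem mainTheorem3 :
    (∀ L : Selectors.Lang, Selectors.Paddable L → Selectors.HasSelector L →
      ∀ R : Selectors.Lang, Selectors.InBPPLogAdvice R L → Selectors.InBPP R L) ∧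
    (∀ L : Selectors.Lang,
      (∀ R : Selectors.Lang, Selectors.InPOneAdvice R L → Selectors.InBPP R L) →
      Selectors.HasSelector L) :=
  ⟨fun _ hpad hsel _ hadv => Selectors.inBPP_of_hasSelector hpad hsel hadv,
    fun _ h => Selectors.hasSelector_of_forall_oracle h⟩
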